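/- Let $N\ge 2$ be an integer and let $B,L\subset\mathbb Z$ be finite sets with $0\in B\cap L$ and $2\le \#B=\#L<N$ such that $(N,B,L)$ is a Hadamard triple, i.e. the matrix $$\Big(\tfrac1{\sqrt{\#B}}\,e^{2\pi i b\ell/N}\Big)_{b\in B,\ \ell\in L}$$ is unitary. For $a\in\mathbb Z$ put $\tau_a(x)=(x+a)/N$ for $x\in\mathbb R$. Let $\mu_{N,B}$ be the self-similar measure of $\{\tau_b\}_{b\in B}$, i.e. the unique Borel probability measure $\mu$ on $\mathbb R$ with $\mu=\frac1{\#B}\sum_{b\in B}\mu\circ\tau_b^{-1}$. Let $K(N,L)$ be the attractor of $\{\tau_\ell\}_{\ell\in L}$, i.e. the unique non-empty compact set $K\subset\mathbb R$ with $K=\bigcup_{\ell\in L}\tau_\ell(K)$; equivalently, $K(N,L)=\big\{\sum_{k\ge1}\ell_kN^{-k}:\ell_k\in L\big\}$. Put $m_B(x)=\frac1{\#B}\sum_{b\in B}e^{2\pi i bx}$. An $m_B$-cycle is a finite set $\{x_1,\dots,x_k\}\subset\mathbb R$, $k\ge1$, for which there are $\ell_1,\dots,\ell_k\in L$ with $\tau_{\ell_j}(x_j)=x_{j+1}$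 for $1\le j\le k-1$ and $\tau_{\ell_k}(x_k)=x_1$, and such that $|m_B(x_j)|=1$ for all $j$. Let $\Lambda\subset\mathbb R$ be the canonical spectrum of $\mu_{N,B}$, i.e. the smallest set that contains $-C$ for all $m_B$-cycles $C$ and satisfies $N\Lambda+L\subset\Lambda$. For a probability measure $\mu$ on $\mathbb R$ and a countable set $\Gamma\subset\mathbb R$, call $(\mu,\Gamma)$ a spectral pair if $\{e^{2\pi i\gamma x}:\gamma\in\Gamma\}$ is an orthonormal basis of $L^2(\mu)$. A real number $t$ is a spectral eigenvalue of a spectral pair $(\mu,\Gamma)$ if $(\mu,t\Gamma)$ is also a spectral pair. Let $d=\gcd(B)$, and for a positive integer $m$ write $\mathbb Z/m=\{k/m:k\in\mathbb Z\}\subset\mathbb R$. Then for every integer $q\ge2$ with $\gcd(q,N)=1$, $q$ is a spectral eigenvalue of $(\mu_{N,B},\Lambda)$ if and only if $$K(N,L)\cap\frac{\mathbb Z}{qd}=K(N,L)\cap\frac{\mathbb Z}{d}.$$ -/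

import Mathlib

open MeasureTheory Filter Topology
open scoped ENNReal

namespace CanonicalSpectrum

/-! ### Hadamard triples -/

/-- The matrix `(1/√#B · e^{2π i b ℓ / N})` with rows `b ∈ B` and columns `ℓ ∈ L`. -/
noncomputable def hadamardMatrix (N : ℕ) (B L : Finset ℤ) : Matrix B L ℂ :=
  Matrix.of fun b l =>
    (1 / (Real.sqrt (B.card : ℝ) : ℂ)) *
      Complex.exp (2 * Real.pi * Complex.I * ((b : ℤ) * (l : ℤ) / (N : ℂ)))

/-- `(N, B, L)` is a Hadamard triple in `ℝ`. -/
structure IsHadamardTriple (N : ℕ) (B L : Finset ℤ) : Prop where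
  two_le : 2 ≤ N
  card_eq : B.card = L.card
  two_le_card : 2 ≤ B.card
  /-- unitarity (both products are required since rows and columns are indexed differently) -/
  mul_conjTranspose : hadamardMatrix N B L * (hadamardMatrix N B L).conjTranspose = 1
  conjTranspose_mul : (hadamardMatrix N B L).conjTranspose * hadamardMatrix N B L = 1

/-- The contraction `τ_a(x) = (x + a) / N`. -/
noncomputable def tau (N : ℕ) (a : ℤ) (x : ℝ) : ℝ := (x + a) / N

/-! ### Self-similar sets -/

/-- The real number with `N`-adic coding `a`, i.e. `∑_{k ≥ 1} a_k N^{-k}` (digits indexed from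
`0` here). -/
noncomputable def coding (N : ℕ) (A : Finset ℤ) (a : ℕ → A) : ℝ :=
  ∑' k : ℕ, ((a k : ℤ) : ℝ) / (N : ℝ) ^ (k + 1)

/-- The self-similar set `K(N, A)`, the set of all sums `∑_{k ≥ 1} a_k N^{-k}` with `a_k ∈ A`.
By `isSelfSimilarSet_iff` below it is the unique non-empty compact `K` with
`K = ⋃_{a ∈ A} τ_a(K)`. -/
def attractor (N : ℕ) (A : Finset ℤ) : Set ℝ := Set.range (coding N A)

/-- `K` is a non-empty compact set invariant under the IFS `{τ_a : a ∈ A}`. -/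
structure IsSelfSimilarSet (N : ℕ) (A : Finset ℤ) (K : Set ℝ) : Prop where
  nonempty : K.Nonempty
  isCompact : IsCompact K
  invariant : K = ⋃ a ∈ A, tau N a '' K

/-! ### Self-similar measures -/

/-- `μ` is a Borel probability measure with `μ = (1/#B) ∑_{b ∈ B} μ ∘ τ_b⁻¹`. -/
structure IsSelfSimilarMeasure (N : ℕ) (B : Finset ℤ) (μ : Measure ℝ) : Prop where
  isProbabilityMeasure : IsProbabilityMeasure μ
  selfSimilar : μ = (B.card : ℝ≥0∞)⁻¹ • ∑ b ∈ B, μ.map (tau N b)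

/-- The self-similar measure `μ_{N,B}`: the measure with `IsSelfSimilarMeasure N B μ`, which
exists and is unique by `existsUnique_isSelfSimilarMeasure` below
(for `N ≥ 2` and `B` non-empty). -/
noncomputable def selfSimilarMeasure (N : ℕ) (B : Finset ℤ) : Measure ℝ :=
  Classical.epsilon (IsSelfSimilarMeasure N B)

/-! ### The canonical spectrum -/

/-- `m_B(x) = (1/#B) ∑_{b ∈ B} e^{2π i b x}`. -/
noncomputable def mask (B : Finset ℤ) (x : ℝ) : ℂ :=
  (1 / (B.card : ℂ)) * ∑ b ∈ B, Complex.exp (2 * Real.pi * Complex.I * b * x)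

/-- `C` is an `m_B`-cycle (extreme cycle) for the IFS `{τ_ℓ : ℓ ∈ L}`: it consists of
`x_0, …, x_k` with `τ_{ℓ_j}(x_j) = x_{j+1}` for suitable `ℓ_j ∈ L`
(indices modulo `k + 1`; addition in `Fin (k + 1)` is cyclic) and `|m_B(x_j)| = 1` for all `j`. -/
def IsExtremeCycle (N : ℕ) (B L : Finset ℤ) (C : Set ℝ) : Prop :=
  ∃ (k : ℕ) (x : Fin (k + 1) → ℝ) (l : Fin (k + 1) → ℤ),
    C = Set.range x ∧ (∀ j, l j ∈ L) ∧ (∀ j, tau N (l j) (x j) = x (j + 1)) ∧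
      ∀ j, ‖mask B (x j)‖ = 1

/-- The canonical spectrum: the smallest set `Λ` that contains `-C` for every `m_B`-cycle `C` and
satisfies `N Λ + L ⊆ Λ`. -/
def canonicalSpectrum (N : ℕ) (B L : Finset ℤ) : Set ℝ :=
  ⋂₀ {S : Set ℝ | (∀ C, IsExtremeCycle N B L C → ∀ x ∈ C, -x ∈ S) ∧
    ∀ s ∈ S, ∀ l ∈ L, (N : ℝ) * s + (l : ℝ) ∈ S}

/-! ### Spectral pairs and spectral eigenvalues -/

/-- `(μ, Λ)` is a spectral pair in `ℝ`: `μ` is a Borel probability measure, `Λ` is countable, and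
the exponentials `e_λ(x) = e^{2π i λ x}`, `λ ∈ Λ`, form an orthonormal basis of `L²(μ)`. -/
structure IsSpectralPair (μ : Measure ℝ) (Λ : Set ℝ) : Prop where
  isProbabilityMeasure : IsProbabilityMeasure μ
  countable : Λ.Countable
  exists_basis : ∃ e : HilbertBasis Λ ℂ (Lp ℂ 2 μ), ∀ l : Λ,
    (e l : ℝ → ℂ) =ᵐ[μ] fun x : ℝ => Complex.exp (2 * Real.pi * Complex.I * (l : ℝ) * x)

/-- `t` is a spectral eigenvalue of the spectral pair `(μ, Λ)`: both `(μ, Λ)` and `(μ, tΛ)` are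
spectral pairs. -/
def IsSpectralEigenvalue (μ : Measure ℝ) (Λ : Set ℝ) (t : ℝ) : Prop :=
  IsSpectralPair μ Λ ∧ IsSpectralPair μ ((fun x : ℝ => t * x) '' Λ)

/-- The set `ℤ/m = {k/m : k ∈ ℤ}` (used for `m ≠ 0`). -/
def intDiv (m : ℤ) : Set ℝ := Set.range fun k : ℤ => (k : ℝ) / (m : ℝ)

/-! ### The self-similar set and measure are well defined -/

section Existence

variable {N : ℕ} {A : Finset ℤ}

theorem exists_digit_bound (A : Finset ℤ) : ∃ M : ℝ, ∀ a ∈ A, |(a : ℝ)| ≤ M :=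
  ⟨∑ a ∈ A, |(a : ℝ)|, fun _ ha =>
    Finset.single_le_sum (f := fun a : ℤ => |(a : ℝ)|) (fun _ _ => abs_nonneg _) ha⟩

theorem coding_term_bound (hN : 2 ≤ N) {M : ℝ} (hM : ∀ a ∈ A, |(a : ℝ)| ≤ M) (a : ℕ → A) (k : ℕ) :
    ‖((a k : ℤ) : ℝ) / (N : ℝ) ^ (k + 1)‖ ≤ M * ((N : ℝ)⁻¹) ^ (k + 1) := by
  rw [norm_div, norm_pow, Real.norm_natCast, inv_pow, div_eq_mul_inv, Real.norm_eq_abs]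
  gcongr
  exact hM _ (a k).2

theorem summable_bound (hN : 2 ≤ N) (M : ℝ) :
    Summable fun k : ℕ => M * ((N : ℝ)⁻¹) ^ (k + 1) := by
  have h2 : (2 : ℝ) ≤ N := by exact_mod_cast hN
  have h : Summable fun k : ℕ => ((N : ℝ)⁻¹) ^ k :=
    summable_geometric_of_lt_one (by positivity) (inv_lt_one_of_one_lt₀ (by linarith))
  exact ((summable_nat_add_iff 1).2 h).mul_left M

theorem summable_coding (hN : 2 ≤ N) (a : ℕ → A) :
    Summable fun k : ℕ => ((a k : ℤ) : ℝ) / (N : ℝ) ^ (k + 1) := by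
  obtain ⟨M, hM⟩ := exists_digit_bound A
  exact Summable.of_norm_bounded (summable_bound hN M) (coding_term_bound hN hM a)

theorem continuous_coding (hN : 2 ≤ N) : Continuous (coding N A) := by
  obtain ⟨M, hM⟩ := exists_digit_bound A
  refine continuous_tsum (fun k => ?_) (summable_bound hN M)
    (fun k a => coding_term_bound hN hM a k)
  have : Continuous fun x : A => ((x : ℤ) : ℝ) := continuous_of_discreteTopology
  exact (this.comp (continuous_apply k)).div_const _

theorem coding_eq (hN : 2 ≤ N) (a : ℕ → A) :
    coding N A a = tau N (a 0) (coding N A fun k => a (k + 1)) := by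
  have hN0 : (N : ℝ) ≠ 0 := by positivity
  unfold coding tau
  rw [(summable_coding hN a).tsum_eq_zero_add, add_div, ← tsum_div_const, add_comm]
  congr 1
  · refine tsum_congr fun k => ?_
    field_simp
    ring
  · simp

theorem tendsto_inv_pow (hN : 2 ≤ N) (y : ℝ) :
    Tendsto (fun n : ℕ => y / (N : ℝ) ^ n) atTop (𝓝 0) := by
  have h2 : (2 : ℝ) ≤ N := by exact_mod_cast hN
  simpa [div_eq_mul_inv] using
    (tendsto_pow_atTop_nhds_zero_of_lt_one (r := ((N : ℝ)⁻¹)) (by positivity)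
      (inv_lt_one_of_one_lt₀ (by linarith))).const_mul y

theorem isSelfSimilarSet_attractor (hN : 2 ≤ N) (hA : A.Nonempty) :
    IsSelfSimilarSet N A (attractor N A) := by
  have : Nonempty A := hA.to_subtype
  refine ⟨Set.range_nonempty _, isCompact_range (continuous_coding hN), ?_⟩
  ext x
  simp only [Set.mem_iUnion, Set.mem_image, attractor]
  constructor
  · rintro ⟨a, rfl⟩
    exact ⟨a 0, (a 0).2, _, ⟨_, rfl⟩, (coding_eq hN a).symm⟩
  · rintro ⟨c, hc, _, ⟨a, rfl⟩, rfl⟩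
    refine ⟨fun k => Nat.casesOn k ⟨c, hc⟩ a, ?_⟩
    rw [coding_eq hN]
    rfl

/-- The self-similar set is the unique non-empty compact invariant set of the IFS. -/
theorem isSelfSimilarSet_iff (hN : 2 ≤ N) (hA : A.Nonempty) (K : Set ℝ) :
    IsSelfSimilarSet N A K ↔ K = attractor N A := by
  refine ⟨fun hK => ?_, fun h => h ▸ isSelfSimilarSet_attractor hN hA⟩
  have hN0 : (N : ℝ) ≠ 0 := by positivity
  have hsum : ∀ a : ℕ → A, Tendsto
      (fun n => ∑ k ∈ Finset.range n, ((a k : ℤ) : ℝ) / (N : ℝ) ^ (k + 1)) atTop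
      (𝓝 (coding N A a)) := fun a => (summable_coding hN a).hasSum.tendsto_sum_nat
  apply Set.Subset.antisymm
  · intro x hx
    have hstep : ∀ y : K, ∃ c : A, ∃ z : K, (y : ℝ) = tau N c z := by
      rintro ⟨y, hy⟩
      have hy' := hy
      rw [hK.invariant] at hy'
      simp only [Set.mem_iUnion, Set.mem_image] at hy'
      obtain ⟨c, hc, z, hz, rfl⟩ := hy'
      exact ⟨⟨c, hc⟩, ⟨z, hz⟩, rfl⟩
    choose c z hz using hstep
    let X : ℕ → K := fun n => z^[n] ⟨x, hx⟩
    have hX : ∀ n, (X n : ℝ) = tau N (c (X n)) (X (n + 1)) := by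
      intro n
      rw [hz (X n)]
      simp only [X, Function.iterate_succ_apply']
    have hx_eq : ∀ n, x = ∑ k ∈ Finset.range n, ((c (X k) : ℤ) : ℝ) / (N : ℝ) ^ (k + 1) +
        (X n : ℝ) / (N : ℝ) ^ n := by
      intro n
      induction n with
      | zero => simp [X]
      | succ n ih =>
        rw [Finset.sum_range_succ, ih, hX n]
        unfold tau
        field_simp
        ring
    obtain ⟨R, hR⟩ := hK.isCompact.isBounded.exists_norm_le
    have hlim0 : Tendsto (fun n => (X n : ℝ) / (N : ℝ) ^ n) atTop (𝓝 0) := by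
      refine squeeze_zero_norm (fun n => ?_) (tendsto_inv_pow hN R)
      rw [norm_div, norm_pow, Real.norm_natCast]
      gcongr
      exact hR _ (X n).2
    have hlim := (hsum fun k => c (X k)).add hlim0
    simp only [← hx_eq, add_zero] at hlim
    exact ⟨fun k => c (X k), tendsto_nhds_unique hlim tendsto_const_nhds⟩
  · rintro _ ⟨a, rfl⟩
    obtain ⟨y, hy⟩ := hK.nonempty
    have hmem : ∀ (n : ℕ) (a : ℕ → A),
        ∑ k ∈ Finset.range n, ((a k : ℤ) : ℝ) / (N : ℝ) ^ (k + 1) + y / (N : ℝ) ^ n ∈ K := by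
      intro n
      induction n with
      | zero => intro a; simpa using hy
      | succ n ih =>
        intro a
        rw [hK.invariant]
        simp only [Set.mem_iUnion, Set.mem_image]
        refine ⟨a 0, (a 0).2, _, ih fun k => a (k + 1), ?_⟩
        rw [Finset.sum_range_succ']
        unfold tau
        rw [add_div, add_div, Finset.sum_div]
        have h1 : ∀ k ∈ Finset.range n, ((a (k + 1) : ℤ) : ℝ) / (N : ℝ) ^ (k + 1) / N =
            ((a (k + 1) : ℤ) : ℝ) / (N : ℝ) ^ (k + 1 + 1) := fun k _ => by field_simp; ring
        rw [Finset.sum_congr rfl h1]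
        field_simp
        ring
    have hlim := (hsum a).add (tendsto_inv_pow hN y)
    rw [add_zero] at hlim
    exact hK.isCompact.isClosed.mem_of_tendsto hlim (Eventually.of_forall fun n => hmem n a)

theorem measurable_tau (b : ℤ) : Measurable (tau N b) := by
  unfold tau
  fun_prop

theorem charFun_selfSimilar {μ : Measure ℝ} (hμ : IsSelfSimilarMeasure N A μ) (t : ℝ) :
    charFun μ t = (A.card : ℂ)⁻¹ *
      ∑ b ∈ A, Complex.exp (t * b / N * Complex.I) * charFun μ (t / N) := by
  have := hμ.isProbabilityMeasure
  have hint : ∀ b ∈ A, Integrable (fun x : ℝ => Complex.exp (t * x * Complex.I))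
      (μ.map (tau N b)) := by
    intro b _
    have : IsProbabilityMeasure (μ.map (tau N b)) :=
      Measure.isProbabilityMeasure_map (measurable_tau b).aemeasurable
    refine Integrable.of_bound (C := 1) (by fun_prop) (Eventually.of_forall fun x => ?_)
    rw [← Complex.ofReal_mul, Complex.norm_exp_ofReal_mul_I]
  conv_lhs => rw [hμ.selfSimilar]
  rw [charFun_apply_real, integral_smul_measure, integral_finsetSum_measure hint]
  simp only [ENNReal.toReal_inv, ENNReal.toReal_natCast, Complex.real_smul]
  push_cast
  congr 1
  refine Finset.sum_congr rfl fun b _ => ?_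
  rw [integral_map (measurable_tau b).aemeasurable (by fun_prop), charFun_apply_real,
    ← integral_const_mul]
  refine integral_congr_ae (Eventually.of_forall fun x => ?_)
  simp only [tau]
  rw [← Complex.exp_add]
  congr 1
  push_cast
  ring

theorem selfSimilarMeasure_unique (hN : 2 ≤ N) (hA : A.Nonempty) {μ ν : Measure ℝ}
    (hμ : IsSelfSimilarMeasure N A μ) (hν : IsSelfSimilarMeasure N A ν) : μ = ν := by
  have := hμ.isProbabilityMeasure
  have := hν.isProbabilityMeasure
  have hcard : (A.card : ℝ) ≠ 0 := by exact_mod_cast hA.card_pos.ne'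
  have hstep : ∀ t, ‖charFun μ t - charFun ν t‖ ≤
      ‖charFun μ (t / N) - charFun ν (t / N)‖ := by
    intro t
    rw [charFun_selfSimilar hμ, charFun_selfSimilar hν, ← mul_sub, ← Finset.sum_sub_distrib,
      norm_mul, norm_inv, Complex.norm_natCast]
    calc (A.card : ℝ)⁻¹ * ‖∑ b ∈ A, (Complex.exp (t * b / N * Complex.I) * charFun μ (t / N) -
            Complex.exp (t * b / N * Complex.I) * charFun ν (t / N))‖
        ≤ (A.card : ℝ)⁻¹ * ∑ b ∈ A, ‖charFun μ (t / N) - charFun ν (t / N)‖ := by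
          gcongr
          refine norm_sum_le_of_le _ fun b _ => ?_
          rw [← mul_sub, norm_mul]
          have : ‖Complex.exp (t * b / N * Complex.I)‖ = 1 := by
            have := Complex.norm_exp_ofReal_mul_I (t * b / N)
            push_cast at this
            exact this
          rw [this, one_mul]
      _ = _ := by
          rw [Finset.sum_const, nsmul_eq_mul, inv_mul_cancel_left₀ hcard]
  have hiter : ∀ (n : ℕ) t, ‖charFun μ t - charFun ν t‖ ≤
      ‖charFun μ (t / (N : ℝ) ^ n) - charFun ν (t / (N : ℝ) ^ n)‖ := by
    intro n
    induction n with
    | zero => intro t; simp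
    | succ n ih =>
      intro t
      refine (ih t).trans ((hstep _).trans_eq ?_)
      rw [div_div, ← pow_succ]
  apply Measure.ext_of_charFun
  ext t
  have hc : Continuous fun s : ℝ => ‖charFun μ s - charFun ν s‖ :=
    ((continuous_charFun (μ := μ)).sub (continuous_charFun (μ := ν))).norm
  have hlim := (hc.tendsto 0).comp (tendsto_inv_pow hN t)
  simp only [charFun_zero, probReal_univ, sub_self, norm_zero] at hlim
  have h0 : ‖charFun μ t - charFun ν t‖ ≤ 0 := ge_of_tendsto' hlim fun n => hiter n t
  exact sub_eq_zero.1 (norm_le_zero_iff.1 h0)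

theorem exists_isSelfSimilarMeasure (hN : 2 ≤ N) (hA : A.Nonempty) :
    ∃ μ, IsSelfSimilarMeasure N A μ := by
  classical
  have : Nonempty A := hA.to_subtype
  have hc0 : (A.card : ℝ≥0∞) ≠ 0 := by exact_mod_cast hA.card_pos.ne'
  have hct : (A.card : ℝ≥0∞) ≠ ∞ := ENNReal.natCast_ne_top _
  -- the uniform measure on the digits and its infinite power
  let U : Measure A := (A.card : ℝ≥0∞)⁻¹ • ∑ b : A, Measure.dirac b
  have : IsProbabilityMeasure U := ⟨by simp [U, ENNReal.inv_mul_cancel hc0 hct]⟩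
  let P : Measure (ℕ → A) := Measure.infinitePi fun _ => U
  let cons : A → (ℕ → A) → (ℕ → A) := fun b a k => Nat.casesOn k b a
  have hcons : ∀ b, Measurable (cons b) := by
    intro b
    refine measurable_pi_lambda _ fun k => ?_
    cases k with
    | zero => exact measurable_const
    | succ k => exact measurable_pi_apply k
  have hP : (A.card : ℝ≥0∞)⁻¹ • ∑ b : A, P.map (cons b) = P := by
    refine Measure.eq_infinitePi _ fun s t ht => ?_
    let s' : Finset ℕ := s.preimage Nat.succ (Nat.succ_injective.injOn)
    have hpre : ∀ b, cons b ⁻¹' (Set.pi s t) =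
        if (0 ∈ s → b ∈ t 0) then Set.pi s' (fun k => t (k + 1)) else ∅ := by
      intro b
      ext a
      split_ifs with h
      · simp only [Set.mem_preimage, Set.mem_pi, Finset.mem_coe, s', Finset.mem_preimage]
        refine ⟨fun H k hk => H (k + 1) hk, fun H k hk => ?_⟩
        cases k with
        | zero => exact h hk
        | succ k => exact H k hk
      · simp only [Set.mem_preimage, Set.mem_pi, Finset.mem_coe, Set.mem_empty_iff_false,
          iff_false]
        intro H
        exact h fun h0 => H 0 h0
    have hval : ∀ b, P.map (cons b) (Set.pi s t) =
        (if (0 ∈ s → b ∈ t 0) then 1 else 0) * ∏ k ∈ s', U (t (k + 1)) := by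
      intro b
      rw [Measure.map_apply (hcons b) (.pi s.countable_toSet fun i _ => ht i), hpre]
      split_ifs
      · rw [one_mul, Measure.infinitePi_pi _ fun i _ => ht _]
      · simp
    have hU0 : U (t 0) = (A.card : ℝ≥0∞)⁻¹ * ∑ b : A, (if b ∈ t 0 then 1 else 0) := by
      simp [U, Set.indicator_apply]
    have hprod : ∏ k ∈ s, U (t k) =
        (if 0 ∈ s then U (t 0) else 1) * ∏ k ∈ s', U (t (k + 1)) := by
      have himg : s'.image Nat.succ = s.erase 0 := by
        ext k
        cases k <;> simp [s']
      have : ∏ k ∈ s', U (t (k + 1)) = ∏ k ∈ s.erase 0, U (t k) := by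
        rw [← himg, Finset.prod_image (Nat.succ_injective.injOn)]
      rw [this]
      split_ifs with h
      · exact (Finset.mul_prod_erase s (fun k => U (t k)) h).symm
      · rw [Finset.erase_eq_of_notMem h, one_mul]
    rw [hprod]
    simp only [Measure.smul_apply, Measure.finsetSum_apply, hval, smul_eq_mul]
    rw [← Finset.sum_mul, ← mul_assoc]
    congr 1
    split_ifs with h
    · simp [h, hU0]
    · simp [h, ENNReal.inv_mul_cancel hc0 hct]
  have hmeas : Measurable (coding N A) := (continuous_coding hN).measurable
  refine ⟨P.map (coding N A), Measure.isProbabilityMeasure_map hmeas.aemeasurable, ?_⟩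
  conv_lhs => rw [← hP]
  rw [← Finset.sum_coe_sort A]
  have hmap : (∑ b : A, P.map (cons b)).map (coding N A) =
      ∑ b : A, (P.map (cons b)).map (coding N A) := by
    ext S hS
    simp [Measure.map_apply hmeas hS]
  rw [Measure.map_smul, hmap]
  congr 1
  refine Finset.sum_congr rfl fun b _ => ?_
  rw [Measure.map_map hmeas (hcons b), Measure.map_map (measurable_tau _) hmeas]
  congr 1
  ext a
  simp only [Function.comp_apply]
  rw [coding_eq hN]
  rfl

/-- Existence and uniqueness of the self-similar measure. -/
theorem existsUnique_isSelfSimilarMeasure (hN : 2 ≤ N) (hA : A.Nonempty) :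
    ∃! μ, IsSelfSimilarMeasure N A μ :=
  (exists_isSelfSimilarMeasure hN hA).elim fun μ hμ =>
    ⟨μ, hμ, fun _ hν => selfSimilarMeasure_unique hN hA hν hμ⟩

theorem isSelfSimilarMeasure_selfSimilarMeasure (hN : 2 ≤ N) (hA : A.Nonempty) :
    IsSelfSimilarMeasure N A (selfSimilarMeasure N A) :=
  Classical.epsilon_spec (exists_isSelfSimilarMeasure hN hA)

end Existence

end CanonicalSpectrum

/-! Write Λ for the canonical spectrum of (N, B, L), K for K(N, L), and qL for the digits of L
multiplied by q. For a primitive N-th root of unity ζ, coprimality gives ζ and ζ^q the same minimal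
polynomial. The vanishing sums that express orthogonality of the columns therefore survive scaling
by q, and (N, B, qL) is again a Hadamard triple (`IsHadamardTriple.image_mul`). Its canonical
spectrum Λ_q is, like Λ, a spectrum of the same measure (`IsHadamardTriple.isSpectralPair`).
Multiplication by q carries extreme cycles for L to extreme cycles for qL, so qΛ ⊆ Λ_q always holds.
Nested spectra coincide (`IsSpectralPair.eq_of_subset`), hence q is an eigenvalue exactly when Λ_q ⊆
qΛ.

The rest concerns cycles. Since |m_B| = 1 exactly on ℤ/d (`norm_mask_eq_one_iff`), an extreme cycle
for qL divided by q is a cycle of the maps for L inside K ∩ ℤ/(qd), and it is extreme for L iff it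
lies in ℤ/d. If K ∩ ℤ/(qd) ⊆ ℤ/d, every extreme cycle for qL thus comes from L, and Λ_q ⊆ qΛ.
Conversely, take a point of K ∩ ℤ/(qd) outside ℤ/d. The tails of its coding stay in that finite set
and, by coprimality, outside ℤ/d. A repetition among them yields an extreme cycle for qL whose
negative is in Λ_q but not in qΛ, because Λ ⊆ ℤ/d.

Completeness of a canonical spectrum rests on F(x) = ∑_{λ ∈ Λ} |μ̂(x + λ)|². It is real analytic, at
most 1, and the average of its values F(τ_ℓ x) with weights |m_B(τ_ℓ x)|² of sum 1. On a large
invariant interval the minimum points of F are invariant under steps of positive weight. If there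
are infinitely many, F is constant and equals F(0) = 1; if finitely many, they include a point of an
extreme cycle, where F = 1. So F is identically 1, which is Parseval's identity for each
exponential, and exponentials are total in L². -/

namespace CanonicalSpectrum

/-! ### The exponential and the mask function -/

/-- The exponential `e^{2π i x}`. -/
noncomputable def expo (x : ℝ) : ℂ := Complex.exp (2 * Real.pi * Complex.I * x)

theorem expo_add (x y : ℝ) : expo (x + y) = expo x * expo y := by
  unfold expo
  rw [← Complex.exp_add]
  push_cast
  ring_nf

theorem expo_zero : expo 0 = 1 := by simp [expo]

theorem norm_expo (x : ℝ) : ‖expo x‖ = 1 := by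
  have := Complex.norm_exp_ofReal_mul_I (2 * Real.pi * x)
  rw [← this, expo]
  push_cast
  ring_nf

theorem conj_expo (x : ℝ) : (starRingEnd ℂ) (expo x) = expo (-x) := by
  unfold expo
  rw [← Complex.exp_conj]
  simp [Complex.conj_ofNat]

theorem expo_eq_one_iff (x : ℝ) : expo x = 1 ↔ ∃ n : ℤ, x = n := by
  unfold expo
  rw [Complex.exp_eq_one_iff]
  have h : (2 * Real.pi * Complex.I : ℂ) ≠ 0 := Complex.two_pi_I_ne_zero
  refine exists_congr fun n => ⟨fun hn => ?_, fun hn => ?_⟩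
  · rw [mul_comm (n : ℂ)] at hn
    exact_mod_cast mul_left_cancel₀ h hn
  · rw [hn]
    push_cast
    ring

theorem expo_int (n : ℤ) : expo n = 1 := (expo_eq_one_iff _).2 ⟨n, rfl⟩

theorem expo_add_int (x : ℝ) (n : ℤ) : expo (x + n) = expo x := by
  rw [expo_add, expo_int, mul_one]

theorem mask_eq (B : Finset ℤ) (x : ℝ) :
    mask B x = (1 / (B.card : ℂ)) * ∑ b ∈ B, expo (b * x) := by
  unfold mask expo
  congr 1
  refine Finset.sum_congr rfl fun b _ => ?_
  push_cast
  ring_nf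

theorem mask_zero {B : Finset ℤ} (hB : B.Nonempty) : mask B 0 = 1 := by
  have : (B.card : ℂ) ≠ 0 := by exact_mod_cast hB.card_pos.ne'
  simp [mask, this]

/-! ### The lattice `ℤ / d` -/

theorem mem_intDiv_iff {d : ℤ} (hd : d ≠ 0) (x : ℝ) : x ∈ intDiv d ↔ ∃ k : ℤ, d * x = k := by
  have : (d : ℝ) ≠ 0 := by exact_mod_cast hd
  unfold intDiv
  simp only [Set.mem_range]
  refine exists_congr fun k => ?_
  rw [div_eq_iff this, eq_comm, mul_comm]

theorem intDiv_add {d : ℤ} {x y : ℝ} (hx : x ∈ intDiv d) (hy : y ∈ intDiv d) :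
    x + y ∈ intDiv d := by
  obtain ⟨k, rfl⟩ := hx
  obtain ⟨m, rfl⟩ := hy
  exact ⟨k + m, by push_cast; ring⟩

theorem intDiv_int_mul {d : ℤ} {x : ℝ} (n : ℤ) (hx : x ∈ intDiv d) : n * x ∈ intDiv d := by
  obtain ⟨k, rfl⟩ := hx
  exact ⟨n * k, by push_cast; ring⟩

theorem intDiv_neg {d : ℤ} {x : ℝ} (hx : x ∈ intDiv d) : -x ∈ intDiv d := by
  simpa using intDiv_int_mul (-1) hx

theorem intDiv_sub {d : ℤ} {x y : ℝ} (hx : x ∈ intDiv d) (hy : y ∈ intDiv d) :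
    x - y ∈ intDiv d := by
  rw [sub_eq_add_neg]
  exact intDiv_add hx (intDiv_neg hy)

theorem int_mem_intDiv {d : ℤ} (hd : d ≠ 0) (n : ℤ) : (n : ℝ) ∈ intDiv d :=
  (mem_intDiv_iff hd _).2 ⟨d * n, by push_cast; ring⟩

theorem gcd_ne_zero_of_two_le_card {B : Finset ℤ} (hB : 2 ≤ B.card) : B.gcd id ≠ 0 := by
  intro h
  rw [Finset.gcd_eq_zero_iff] at h
  have : B ⊆ {0} := fun b hb => by simpa using h b hb
  have := Finset.card_le_card this
  simp at this
  omega

/-- The integers m with mx ∈ ℤ form a subgroup of ℤ, hence are the multiples of one g; if B lies in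
it, then g divides gcd(B). This is Bézout without coefficients. -/
theorem forall_mul_int_iff {B : Finset ℤ} (hB : 2 ≤ B.card) (x : ℝ) :
    (∀ b ∈ B, ∃ n : ℤ, (b : ℝ) * x = n) ↔ x ∈ intDiv (B.gcd id) := by
  rw [mem_intDiv_iff (gcd_ne_zero_of_two_le_card hB)]
  constructor
  · intro h
    let S : AddSubgroup ℤ :=
      { carrier := {m | ∃ n : ℤ, (m : ℝ) * x = n}
        add_mem' := by
          rintro a b ⟨n, hn⟩ ⟨m, hm⟩
          exact ⟨n + m, by push_cast; rw [add_mul, hn, hm]⟩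
        zero_mem' := ⟨0, by simp⟩
        neg_mem' := by
          rintro a ⟨n, hn⟩
          exact ⟨-n, by push_cast; rw [neg_mul, hn]⟩ }
    obtain ⟨g, hg⟩ := Int.subgroup_cyclic S
    have hdvd : g ∣ B.gcd id := Finset.dvd_gcd fun b hb => by
      have : b ∈ S := h b hb
      rw [hg, AddSubgroup.mem_closure_singleton] at this
      obtain ⟨k, hk⟩ := this
      exact ⟨k, by rw [id, ← hk, smul_eq_mul, mul_comm]⟩
    obtain ⟨k, hk⟩ := hdvd
    have : B.gcd id ∈ S := by
      rw [hg, AddSubgroup.mem_closure_singleton]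
      exact ⟨k, by rw [hk, smul_eq_mul, mul_comm]⟩
    exact this
  · rintro ⟨k, hk⟩ b hb
    obtain ⟨c, hc⟩ : B.gcd id ∣ b := Finset.gcd_dvd (f := id) hb
    refine ⟨c * k, ?_⟩
    conv_lhs => rw [hc]
    push_cast
    rw [← hk]
    ring

theorem mask_add_of_mem_intDiv {B : Finset ℤ} (hB : 2 ≤ B.card) {x : ℝ}
    (hx : x ∈ intDiv (B.gcd id)) (y : ℝ) : mask B (y + x) = mask B y := by
  rw [mask_eq, mask_eq]
  congr 1
  refine Finset.sum_congr rfl fun b hb => ?_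
  obtain ⟨n, hn⟩ := (forall_mul_int_iff hB x).2 hx b hb
  rw [mul_add, hn, expo_add_int]

/-- Equality in the triangle inequality: an average of unit numbers has modulus 1 only if they all
agree, and 0 ∈ B makes the common value 1. Extremality of a cycle thereby becomes membership in a
lattice. -/
theorem norm_mask_eq_one_iff {B : Finset ℤ} (hB : 2 ≤ B.card) (hB0 : (0 : ℤ) ∈ B) (x : ℝ) :
    ‖mask B x‖ = 1 ↔ x ∈ intDiv (B.gcd id) := by
  have hne : B.Nonempty := ⟨0, hB0⟩
  have hc : (B.card : ℂ) ≠ 0 := by exact_mod_cast hne.card_pos.ne'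
  constructor
  · intro h
    rw [← forall_mul_int_iff hB]
    set u := mask B x with hu
    have hsum : ∑ b ∈ B, expo (b * x) = B.card * u := by
      rw [hu, mask_eq, ← mul_assoc, mul_one_div_cancel hc, one_mul]
    have huu : u * (starRingEnd ℂ) u = 1 := by
      rw [Complex.mul_conj, Complex.normSq_eq_norm_sq, h]
      simp
    -- Every summand is nonnegative, so each vanishes; a unit number with real part 1 is 1.
    have hre : ∑ b ∈ B, (1 - (expo (b * x) * (starRingEnd ℂ) u).re) = 0 := by
      rw [Finset.sum_sub_distrib, ← Complex.re_sum, ← Finset.sum_mul, hsum, mul_assoc, huu]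
      simp
    have hle : ∀ z : ℝ, ‖expo z * (starRingEnd ℂ) u‖ = 1 := fun z => by
      rw [norm_mul, norm_expo, Complex.norm_conj, h, one_mul]
    have h1 : ∀ b ∈ B, expo (b * x) = u := by
      intro b hb
      have := (Finset.sum_eq_zero_iff_of_nonneg fun c _ => by
        have := Complex.re_le_norm (expo (c * x) * (starRingEnd ℂ) u)
        rw [hle] at this
        linarith).1 hre b hb
      have hre1 : (expo (b * x) * (starRingEnd ℂ) u).re = 1 := by linarith
      have h2 : expo (b * x) * (starRingEnd ℂ) u = 1 := by
        have hn := hle (b * x)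
        have hsq := Complex.normSq_eq_norm_sq (expo (b * x) * (starRingEnd ℂ) u)
        rw [hn, Complex.normSq_apply, hre1] at hsq
        apply Complex.ext
        · simpa using hre1
        · simp only [Complex.one_im]
          nlinarith
      calc expo (b * x) = expo (b * x) * (u * (starRingEnd ℂ) u) := by rw [huu, mul_one]
        _ = expo (b * x) * (starRingEnd ℂ) u * u := by ring
        _ = u := by rw [h2, one_mul]
    have h0 : u = 1 := by
      rw [← h1 0 hB0]
      simp [expo_zero]
    intro b hb
    rw [← expo_eq_one_iff, h1 b hb, h0]
  · intro h
    have := mask_add_of_mem_intDiv hB h 0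
    rw [zero_add, mask_zero hne] at this
    rw [this, norm_one]

/-! ### Consequences of the Hadamard condition -/

theorem hadamardMatrix_apply (N : ℕ) (B L : Finset ℤ) (b : B) (l : L) :
    hadamardMatrix N B L b l =
      (1 / (Real.sqrt (B.card : ℝ) : ℂ)) * expo ((b : ℤ) * (l : ℤ) / N) := by
  simp [hadamardMatrix, expo]

theorem inv_sqrt_mul_inv_sqrt (n : ℕ) :
    (1 / (Real.sqrt (n : ℝ) : ℂ)) * (1 / (Real.sqrt (n : ℝ) : ℂ)) = 1 / (n : ℂ) := by
  rw [div_mul_div_comm, one_mul, ← Complex.ofReal_mul, Real.mul_self_sqrt (Nat.cast_nonneg n)]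
  simp

theorem hadamardMatrix_conjTranspose_mul_apply (N : ℕ) (B L : Finset ℤ) (l l' : L) :
    ((hadamardMatrix N B L).conjTranspose * hadamardMatrix N B L) l l' =
      mask B (((l' : ℤ) - (l : ℤ) : ℝ) / N) := by
  rw [Matrix.mul_apply, mask_eq, ← Finset.sum_coe_sort B, Finset.mul_sum]
  refine Finset.sum_congr rfl fun b _ => ?_
  rw [Matrix.conjTranspose_apply, hadamardMatrix_apply, hadamardMatrix_apply, star_mul',
    ← inv_sqrt_mul_inv_sqrt]
  have h1 : star (1 / (Real.sqrt (B.card : ℝ) : ℂ)) = 1 / (Real.sqrt (B.card : ℝ) : ℂ) := by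
    simp
  have h2 : star (expo ((b : ℤ) * (l : ℤ) / N)) = expo (-((b : ℤ) * (l : ℤ) / N)) :=
    conj_expo _
  have h3 : ((b : ℤ) : ℝ) * (((l' : ℤ) - (l : ℤ) : ℝ) / N) =
      -((b : ℤ) * (l : ℤ) / N) + (b : ℤ) * (l' : ℤ) / N := by ring
  rw [h1, h2, h3, expo_add]
  ring

theorem hadamardMatrix_mul_conjTranspose_apply (N : ℕ) (B L : Finset ℤ) (b b' : B) :
    (hadamardMatrix N B L * (hadamardMatrix N B L).conjTranspose) b b' =
      1 / (B.card : ℂ) * ∑ l ∈ L, expo (((b : ℤ) - (b' : ℤ)) * l / N) := by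
  rw [Matrix.mul_apply, ← Finset.sum_coe_sort L, Finset.mul_sum]
  refine Finset.sum_congr rfl fun l _ => ?_
  rw [Matrix.conjTranspose_apply, hadamardMatrix_apply, hadamardMatrix_apply, star_mul',
    ← inv_sqrt_mul_inv_sqrt]
  have h1 : star (1 / (Real.sqrt (B.card : ℝ) : ℂ)) = 1 / (Real.sqrt (B.card : ℝ) : ℂ) := by
    simp
  have h2 : star (expo ((b' : ℤ) * (l : ℤ) / N)) = expo (-((b' : ℤ) * (l : ℤ) / N)) :=
    conj_expo _
  have h3 : (((b : ℤ) : ℝ) - ((b' : ℤ) : ℝ)) * ((l : ℤ) : ℝ) / N =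
      (b : ℤ) * (l : ℤ) / N + -((b' : ℤ) * (l : ℤ) / N) := by ring
  rw [h1, h2, h3, expo_add]
  ring

theorem IsHadamardTriple.mask_sub_div {N : ℕ} {B L : Finset ℤ} (h : IsHadamardTriple N B L)
    {l l' : ℤ} (hl : l ∈ L) (hl' : l' ∈ L) (hne : l ≠ l') : mask B (((l : ℝ) - l') / N) = 0 := by
  have := hadamardMatrix_conjTranspose_mul_apply N B L ⟨l', hl'⟩ ⟨l, hl⟩
  rw [h.conjTranspose_mul, Matrix.one_apply_ne (by simpa using hne.symm)] at this
  exact this.symm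

/-- The quadrature mirror filter condition. -/
theorem IsHadamardTriple.sum_norm_mask_sq {N : ℕ} {B L : Finset ℤ} (h : IsHadamardTriple N B L)
    (x : ℝ) : ∑ l ∈ L, ‖mask B (tau N l x)‖ ^ 2 = 1 := by
  have hc : (B.card : ℂ) ≠ 0 := by
    have := h.two_le_card
    norm_cast
    omega
  -- Orthogonality of the rows: after expanding the squares, only the diagonal terms b = b' survive,
  -- each contributing 1/#B.
  have horth : ∀ b ∈ B, ∀ b' ∈ B, (1 / (B.card : ℂ)) *
      ∑ l ∈ L, expo (((b : ℝ) - b') * l / N) = if b = b' then 1 else 0 := by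
    intro b hb b' hb'
    have := hadamardMatrix_mul_conjTranspose_apply N B L ⟨b, hb⟩ ⟨b', hb'⟩
    rw [h.mul_conjTranspose, Matrix.one_apply] at this
    rw [← this]
    simp
  have hterm : ∀ l ∈ L, ((‖mask B (tau N l x)‖ ^ 2 : ℝ) : ℂ) =
      ∑ b ∈ B, ∑ b' ∈ B, 1 / (B.card : ℂ) * expo (((b : ℝ) - b') * x / N) *
        ((1 / (B.card : ℂ)) * expo (((b : ℝ) - b') * l / N)) := by
    intro l _
    rw [Complex.ofReal_pow, ← Complex.mul_conj', mask_eq, map_mul, map_sum,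
      mul_mul_mul_comm, Finset.sum_mul_sum, Finset.mul_sum]
    refine Finset.sum_congr rfl fun b _ => ?_
    rw [Finset.mul_sum]
    refine Finset.sum_congr rfl fun b' _ => ?_
    rw [conj_expo, ← expo_add]
    have : (b : ℝ) * tau N l x + -(b' * tau N l x) =
        ((b : ℝ) - b') * x / N + ((b : ℝ) - b') * l / N := by
      unfold tau
      ring
    rw [this, expo_add]
    simp only [map_div₀, map_one, map_natCast]
    ring
  have hC : ((∑ l ∈ L, ‖mask B (tau N l x)‖ ^ 2 : ℝ) : ℂ) = 1 := by
    rw [Complex.ofReal_sum, Finset.sum_congr rfl hterm, Finset.sum_comm]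
    have : ∀ b ∈ B, ∑ l ∈ L, ∑ b' ∈ B, 1 / (B.card : ℂ) * expo (((b : ℝ) - b') * x / N) *
        ((1 / (B.card : ℂ)) * expo (((b : ℝ) - b') * l / N)) = 1 / (B.card : ℂ) := by
      intro b hb
      rw [Finset.sum_comm]
      have h2 : ∀ b' ∈ B, ∑ l ∈ L, 1 / (B.card : ℂ) * expo (((b : ℝ) - b') * x / N) *
        ((1 / (B.card : ℂ)) * expo (((b : ℝ) - b') * l / N)) =
          if b = b' then 1 / (B.card : ℂ) else 0 := by
        intro b' hb'
        rw [← Finset.mul_sum, ← Finset.mul_sum, horth b hb b' hb']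
        split_ifs with hbb
        · simp [hbb, expo_zero]
        · simp
      rw [Finset.sum_congr rfl h2, Finset.sum_ite_eq, if_pos hb]
    rw [Finset.sum_congr rfl this, Finset.sum_const, nsmul_eq_mul, mul_one_div_cancel hc]
  exact_mod_cast hC

/-- A vanishing sum of `N`-th roots of unity stays zero under the Galois action. -/
theorem mask_mul_div_eq_zero {N q : ℕ} (hN : 2 ≤ N) (hqN : Nat.gcd q N = 1) {B : Finset ℤ}
    {m : ℤ} (hm : mask B ((m : ℝ) / N) = 0) : mask B ((q * m : ℝ) / N) = 0 := by
  rcases B.eq_empty_or_nonempty with rfl | hB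
  · simp [mask]
  have hc : (1 / (B.card : ℂ)) ≠ 0 := by
    have : (B.card : ℂ) ≠ 0 := by exact_mod_cast hB.card_pos.ne'
    simpa using this
  have hN0 : (N : ℝ) ≠ 0 := by positivity
  rw [mask_eq] at hm ⊢
  have hm := (mul_eq_zero.1 hm).resolve_left hc
  set ζ : ℂ := expo (1 / N) with hζ
  have hprim : IsPrimitiveRoot ζ N := by
    have := Complex.isPrimitiveRoot_exp N (by omega)
    convert this using 1
    rw [hζ, expo]
    push_cast
    ring_nf
  have hpow : ∀ k : ℕ, ζ ^ k = expo (k / N) := by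
    intro k
    rw [hζ, expo, expo, ← Complex.exp_nat_mul]
    push_cast
    ring_nf
  -- Reducing exponents modulo `N` makes them natural numbers, so the sum is an integer polynomial
  -- evaluated at a power of ζ.
  let e : ℤ → ℕ := fun b => ((b * m) % N).toNat
  have he : ∀ b : ℤ, ∃ k : ℤ, (b * m : ℝ) = e b + N * k := by
    intro b
    refine ⟨b * m / N, ?_⟩
    have h0 : 0 ≤ (b * m) % N := Int.emod_nonneg _ (by omega)
    have h1 : ((e b : ℕ) : ℤ) = (b * m) % N := Int.toNat_of_nonneg h0
    have h2 : b * m = (e b : ℤ) + N * (b * m / N) := by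
      rw [h1]
      exact (Int.emod_add_mul_ediv _ _).symm
    exact_mod_cast h2
  let P : Polynomial ℤ := ∑ b ∈ B, Polynomial.X ^ e b
  have hP : ∀ r : ℕ, Polynomial.aeval (ζ ^ r) P = ∑ b ∈ B, expo (b * ((r * m : ℝ) / N)) := by
    intro r
    simp only [P, map_sum, map_pow, Polynomial.aeval_X]
    refine Finset.sum_congr rfl fun b _ => ?_
    obtain ⟨k, hk⟩ := he b
    have : (b : ℝ) * ((r * m : ℝ) / N) = ((r * e b : ℕ) : ℝ) / N + ((r * k : ℤ) : ℝ) := by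
      have : (b : ℝ) * ((r * m : ℝ) / N) = r * (b * m) / N := by ring
      rw [this, hk]
      push_cast
      field_simp
    rw [this, expo_add_int, ← hpow, pow_mul]
  have h1 : Polynomial.aeval ζ P = 0 := by
    have := hP 1
    simp only [pow_one, Nat.cast_one, one_mul] at this
    rw [this, hm]
  have hdvd := minpoly.isIntegrallyClosed_dvd (hprim.isIntegral (by omega)) h1
  -- The Galois step: the minimal polynomial of ζ, which divides `P`, is also that of ζ^q.
  rw [hprim.minpoly_eq_pow_coprime hqN] at hdvd
  have h2 : Polynomial.aeval (ζ ^ q) P = 0 := by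
    obtain ⟨Q, hQ⟩ := hdvd
    rw [hQ, map_mul, minpoly.aeval, zero_mul]
  rw [← hP q, h2, mul_zero]

theorem IsHadamardTriple.image_mul {N q : ℕ} {B L : Finset ℤ} (h : IsHadamardTriple N B L)
    (hq : q ≠ 0) (hqN : Nat.gcd q N = 1) :
    IsHadamardTriple N B (L.image fun l => (q : ℤ) * l) := by
  have hinj : Function.Injective fun l : ℤ => (q : ℤ) * l :=
    mul_right_injective₀ (by exact_mod_cast hq)
  have hcard : B.card = (L.image fun l => (q : ℤ) * l).card := by
    rw [Finset.card_image_of_injective _ hinj, h.card_eq]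
  have hmul : (hadamardMatrix N B (L.image fun l => (q : ℤ) * l)).conjTranspose *
      hadamardMatrix N B (L.image fun l => (q : ℤ) * l) = 1 := by
    ext ⟨l, hl⟩ ⟨l', hl'⟩
    rw [hadamardMatrix_conjTranspose_mul_apply]
    by_cases hll : l = l'
    · subst hll
      simp only [sub_self, zero_div, Matrix.one_apply_eq]
      exact mask_zero (Finset.card_pos.1 (by have := h.two_le_card; omega))
    · rw [Matrix.one_apply_ne (by simpa using hll)]
      obtain ⟨k, hk, rfl⟩ := Finset.mem_image.1 hl
      obtain ⟨k', hk', rfl⟩ := Finset.mem_image.1 hl'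
      have hkk : k' ≠ k := by
        rintro rfl
        exact hll rfl
      have h0 := h.mask_sub_div hk' hk hkk
      have := mask_mul_div_eq_zero h.two_le hqN (m := k' - k) (B := B) (by push_cast; exact h0)
      convert this using 2
      push_cast
      ring
  refine ⟨h.two_le, hcard, h.two_le_card, ?_, hmul⟩
  -- For a matrix with equally many rows and columns, a one-sided inverse is two-sided.
  exact (Matrix.mul_eq_one_comm_of_card_eq _ _ _ (by simpa using hcard.symm)).1 hmul

/-- Distinct elements of `L` are incongruent modulo `N`. -/
theorem IsHadamardTriple.not_dvd_sub {N : ℕ} {B L : Finset ℤ} (h : IsHadamardTriple N B L)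
    {l l' : ℤ} (hl : l ∈ L) (hl' : l' ∈ L) (hne : l ≠ l') : ¬ (N : ℤ) ∣ l - l' := by
  rintro ⟨k, hk⟩
  have h0 := h.mask_sub_div hl hl' hne
  have hN : (N : ℝ) ≠ 0 := by
    have := h.two_le
    positivity
  have h1 : ((l : ℝ) - l') / N = 0 + k := by
    rw [div_eq_iff hN]
    have : ((l - l' : ℤ) : ℝ) = ((N * k : ℤ) : ℝ) := by rw [hk]
    push_cast at this
    rw [this]
    ring
  rw [h1, mask_add_of_mem_intDiv h.two_le_card
    (int_mem_intDiv (gcd_ne_zero_of_two_le_card h.two_le_card) k), mask_zero] at h0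
  · exact one_ne_zero h0
  · exact Finset.card_pos.1 (by have := h.two_le_card; omega)

/-! ### Exponentials in `L²` and the Fourier transform of a measure -/

@[fun_prop]
theorem continuous_expo : Continuous expo := by
  unfold expo
  fun_prop

theorem memLp_expo (μ : Measure ℝ) [IsFiniteMeasure μ] (t : ℝ) (p : ℝ≥0∞) :
    MemLp (fun x : ℝ => expo (t * x)) p μ :=
  MemLp.of_bound (by fun_prop) 1 (Eventually.of_forall fun x => (norm_expo _).le)

/-- The exponential `x ↦ e^{2π i t x}` as an element of `L²(μ)`. -/
noncomputable def expLp (μ : Measure ℝ) [IsFiniteMeasure μ] (t : ℝ) : Lp ℂ 2 μ :=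
  (memLp_expo μ t 2).toLp _

theorem coeFn_expLp (μ : Measure ℝ) [IsFiniteMeasure μ] (t : ℝ) :
    (expLp μ t : ℝ → ℂ) =ᵐ[μ] fun x => expo (t * x) :=
  (memLp_expo μ t 2).coeFn_toLp

/-- The Fourier transform `t ↦ ∫ e^{2π i t x} dμ(x)` of a measure. -/
noncomputable def muHat (μ : Measure ℝ) (t : ℝ) : ℂ := ∫ x, expo (t * x) ∂μ

theorem muHat_eq_charFun (μ : Measure ℝ) (t : ℝ) : muHat μ t = charFun μ (2 * Real.pi * t) := by
  rw [muHat, charFun_apply_real]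
  congr 1
  ext x
  unfold expo
  push_cast
  ring_nf

theorem muHat_zero (μ : Measure ℝ) [IsProbabilityMeasure μ] : muHat μ 0 = 1 := by
  simp [muHat, expo_zero]

theorem norm_muHat_neg (μ : Measure ℝ) (t : ℝ) : ‖muHat μ (-t)‖ = ‖muHat μ t‖ := by
  rw [muHat_eq_charFun, muHat_eq_charFun, mul_neg, charFun_neg, Complex.norm_conj]

theorem inner_expLp_left (μ : Measure ℝ) [IsFiniteMeasure μ] (s : ℝ) (g : Lp ℂ 2 μ) :
    inner ℂ (expLp μ s) g = ∫ x, expo (-s * x) * g x ∂μ := by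
  rw [L2.inner_def]
  refine integral_congr_ae ?_
  filter_upwards [coeFn_expLp μ s] with x hx
  rw [hx, RCLike.inner_apply, conj_expo, mul_comm, neg_mul]

theorem inner_expLp (μ : Measure ℝ) [IsFiniteMeasure μ] (s t : ℝ) :
    inner ℂ (expLp μ s) (expLp μ t) = muHat μ (t - s) := by
  rw [inner_expLp_left]
  refine integral_congr_ae ?_
  filter_upwards [coeFn_expLp μ t] with x hx
  rw [hx, ← expo_add]
  ring_nf

theorem norm_expLp (μ : Measure ℝ) [IsProbabilityMeasure μ] (t : ℝ) : ‖expLp μ t‖ = 1 := by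
  have h := inner_self_eq_norm_sq_to_K (𝕜 := ℂ) (expLp μ t)
  rw [inner_expLp, sub_self, muHat_zero] at h
  have h2 : ‖expLp μ t‖ ^ 2 = 1 := by
    apply Complex.ofReal_injective
    rw [Complex.ofReal_one, h]
    push_cast
    rfl
  exact (pow_eq_one_iff_of_nonneg (norm_nonneg _) two_ne_zero).1 h2

theorem IsSelfSimilarMeasure.muHat_eq {N : ℕ} {B : Finset ℤ} {μ : Measure ℝ}
    (hμ : IsSelfSimilarMeasure N B μ) (t : ℝ) :
    muHat μ t = mask B (t / N) * muHat μ (t / N) := by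
  rw [muHat_eq_charFun, charFun_selfSimilar hμ, muHat_eq_charFun, mask_eq, ← Finset.sum_mul,
    ← mul_assoc, one_div]
  have h : ∀ b ∈ B, Complex.exp (((2 * Real.pi * t : ℝ) : ℂ) * b / N * Complex.I) =
      expo (b * (t / N)) := by
    intro b _
    unfold expo
    push_cast
    ring_nf
  rw [Finset.sum_congr rfl h, mul_div_assoc]

/-! ### Compact support -/

/-- If |τ_b x| > M + s, then |x| > N(M + s) − M ≥ M + 2s. By self-similarity the mass beyond M + s
is at most that beyond M + 2s; iterating pushes it to infinity, so it is 0. -/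
theorem IsSelfSimilarMeasure.ae_abs_le {N : ℕ} {B : Finset ℤ} {μ : Measure ℝ} (hN : 2 ≤ N)
    (hB : B.Nonempty) (hμ : IsSelfSimilarMeasure N B μ) {M : ℝ} (hM : ∀ b ∈ B, |(b : ℝ)| ≤ M) :
    ∀ᵐ x ∂μ, |x| ≤ M := by
  have := hμ.isProbabilityMeasure
  have hc0 : (B.card : ℝ≥0∞) ≠ 0 := by exact_mod_cast hB.card_pos.ne'
  have hct : (B.card : ℝ≥0∞) ≠ ∞ := ENNReal.natCast_ne_top _
  have h2 : (2 : ℝ) ≤ N := by exact_mod_cast hN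
  have hmeas : ∀ r : ℝ, MeasurableSet {x : ℝ | r < |x|} := fun r =>
    measurableSet_lt measurable_const measurable_id.abs
  have hstep : ∀ s : ℝ, 0 ≤ s → μ {x | M + s < |x|} ≤ μ {x | M + 2 * s < |x|} := by
    intro s hs
    conv_lhs => rw [hμ.selfSimilar]
    rw [Measure.smul_apply, Measure.finsetSum_apply, smul_eq_mul]
    calc (B.card : ℝ≥0∞)⁻¹ * ∑ b ∈ B, (μ.map (tau N b)) {x | M + s < |x|}
        ≤ (B.card : ℝ≥0∞)⁻¹ * ∑ b ∈ B, μ {x | M + 2 * s < |x|} := by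
          refine mul_le_mul_right (Finset.sum_le_sum fun b hb => ?_) _
          rw [Measure.map_apply (measurable_tau b) (hmeas _)]
          refine measure_mono fun x hx => ?_
          simp only [Set.mem_preimage, Set.mem_ofPred_eq, tau, abs_div, Nat.abs_cast] at hx ⊢
          rw [lt_div_iff₀ (by linarith)] at hx
          have h3 := abs_add_le x (b : ℝ)
          have h4 := hM b hb
          have h5 := abs_nonneg (b : ℝ)
          nlinarith
      _ = μ {x | M + 2 * s < |x|} := by
          rw [Finset.sum_const, nsmul_eq_mul, ← mul_assoc, ENNReal.inv_mul_cancel hc0 hct, one_mul]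
  have hiter : ∀ (s : ℝ), 0 < s → ∀ n : ℕ, μ {x | M + s < |x|} ≤ μ {x | M + n * s < |x|} := by
    intro s hs n
    have h : ∀ k : ℕ, μ {x | M + s < |x|} ≤ μ {x | M + 2 ^ k * s < |x|} := by
      intro k
      induction k with
      | zero => simp
      | succ k ih =>
        refine ih.trans ((hstep (2 ^ k * s) (by positivity)).trans_eq ?_)
        rw [← mul_assoc, ← pow_succ']
    refine (h n).trans (measure_mono fun x hx => ?_)
    have : (n : ℝ) ≤ 2 ^ n := by exact_mod_cast Nat.lt_two_pow_self.le
    simp only [Set.mem_ofPred_eq] at hx ⊢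
    nlinarith
  have hzero : ∀ s : ℝ, 0 < s → μ {x | M + s < |x|} = 0 := by
    intro s hs
    have hanti : Antitone fun n : ℕ => {x : ℝ | M + n * s < |x|} := by
      intro m n hmn x hx
      have : (m : ℝ) ≤ n := by exact_mod_cast hmn
      simp only [Set.mem_ofPred_eq] at hx ⊢
      nlinarith
    have hempty : (⋂ n : ℕ, {x : ℝ | M + n * s < |x|}) = ∅ := by
      ext x
      simp only [Set.mem_iInter, Set.mem_ofPred_eq, Set.mem_empty_iff_false, iff_false, not_forall,
        not_lt]
      obtain ⟨n, hn⟩ := exists_nat_ge ((|x| - M) / s)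
      refine ⟨n, ?_⟩
      rw [div_le_iff₀ hs] at hn
      linarith
    have hlim := tendsto_measure_iInter_atTop (μ := μ)
      (fun n : ℕ => (hmeas (M + n * s)).nullMeasurableSet) hanti ⟨0, measure_ne_top _ _⟩
    rw [hempty, measure_empty] at hlim
    exact le_antisymm (ge_of_tendsto' hlim (hiter s hs)) bot_le
  have hall : ∀ᵐ x ∂μ, ∀ n : ℕ, ¬ M + 1 / ((n : ℝ) + 1) < |x| := by
    rw [ae_all_iff]
    intro n
    rw [ae_iff]
    simpa using hzero (1 / ((n : ℝ) + 1)) (by positivity)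
  filter_upwards [hall] with x hx
  refine le_of_forall_pos_le_add fun ε hε => ?_
  obtain ⟨n, hn⟩ := exists_nat_one_div_lt hε
  have := hx n
  push Not at this
  linarith

/-! ### Analyticity of `t ↦ e_t` -/

/-- On the bounded support, e_t is exp(t f) in the Banach algebra of bounded continuous functions,
where f is 2πix with x clamped to [−|M|, |M|]. The Banach-algebra exponential is analytic, and the
map into L² is bounded and linear. -/
theorem analyticOnNhd_expLp {μ : Measure ℝ} [IsFiniteMeasure μ] {M : ℝ}
    (hM : ∀ᵐ x ∂μ, |x| ≤ M) : AnalyticOnNhd ℝ (expLp μ) Set.univ := by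
  let f : BoundedContinuousFunction ℝ ℂ :=
    BoundedContinuousFunction.ofNormedAddCommGroup
      (fun x : ℝ => (2 * Real.pi * Complex.I) * ((max (-|M|) (min x |M|) : ℝ) : ℂ))
      (by fun_prop) (2 * Real.pi * |M|) (fun x => by
        rw [norm_mul, Complex.norm_real, Real.norm_eq_abs]
        have h1 : ‖(2 * Real.pi * Complex.I : ℂ)‖ = 2 * Real.pi := by
          simp [abs_of_pos Real.pi_pos]
        rw [h1]
        refine mul_le_mul_of_nonneg_left ?_ (by positivity)
        rw [abs_le]
        exact ⟨le_max_left _ _, max_le (by linarith [abs_nonneg M]) (min_le_right _ _)⟩)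
  let T : BoundedContinuousFunction ℝ ℂ →L[ℝ] Lp ℂ 2 μ :=
    (BoundedContinuousFunction.toLp (p := 2) μ ℂ).restrictScalars ℝ
  have hexp : ∀ (t x : ℝ), (NormedSpace.exp (t • f)) x = Complex.exp (t * f x) := by
    intro t x
    let ev : BoundedContinuousFunction ℝ ℂ →ₐ[ℂ] ℂ :=
      { toFun := fun g => g x
        map_one' := rfl
        map_mul' := fun _ _ => rfl
        map_zero' := rfl
        map_add' := fun _ _ => rfl
        commutes' := fun _ => rfl }
    have hev : Continuous ev := 
      (BoundedContinuousFunction.lipschitz_eval_const x).continuous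
    have := NormedSpace.map_exp ev hev (t • f)
    rw [Complex.exp_eq_exp_ℂ]
    have h2 : ev (t • f) = t * f x := Complex.real_smul
    rw [h2] at this
    exact this
  have hfun : expLp μ = fun t : ℝ => T (NormedSpace.exp (t • f)) := by
    funext t
    apply Lp.ext
    refine (coeFn_expLp μ t).trans ?_
    have h1 := BoundedContinuousFunction.coeFn_toLp (p := 2) μ ℂ (NormedSpace.exp (t • f))
    refine EventuallyEq.trans ?_ h1.symm
    filter_upwards [hM] with x hx
    rw [hexp]
    have hx' := abs_le.1 (hx.trans (le_abs_self M))
    have hfx : f x = (2 * Real.pi * Complex.I) * (x : ℂ) := by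
      change (2 * Real.pi * Complex.I) * ((max (-|M|) (min x |M|) : ℝ) : ℂ) = _
      rw [min_eq_left hx'.2, max_eq_right hx'.1]
    rw [hfx, expo]
    push_cast
    ring_nf
  rw [hfun]
  intro t _
  refine (T.analyticAt _).comp ?_
  have h2 : AnalyticAt ℝ (NormedSpace.exp : BoundedContinuousFunction ℝ ℂ → _) (t • f) :=
    NormedSpace.exp_analytic (𝕂 := ℝ) _
  have h3 : AnalyticAt ℝ (fun s : ℝ => s • f) t := by fun_prop
  exact AnalyticAt.fun_comp h2 h3

/-! ### Totality of the exponentials -/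

/-- The positive and negative parts of h are densities of two finite measures with the same
characteristic function. The measures coincide, so both parts agree almost everywhere and h
vanishes. -/
theorem ae_eq_zero_of_integral_expo_mul_real {μ : Measure ℝ} [IsFiniteMeasure μ] {h : ℝ → ℝ}
    (hh : Integrable h μ) (h0 : ∀ t, ∫ x, expo (t * x) * (h x : ℂ) ∂μ = 0) : h =ᵐ[μ] 0 := by
  have hm : AEMeasurable h μ := hh.aemeasurable
  let ν : ℝ → Measure ℝ := fun s => μ.withDensity fun x => ENNReal.ofReal (s * h x)
  have hfin : ∀ s, IsFiniteMeasure (ν s) := fun s =>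
    isFiniteMeasure_withDensity_ofReal (hh.const_mul s).2
  have hint : ∀ s, Integrable (fun x => max (s * h x) 0) μ := fun s =>
    (hh.const_mul s).pos_part
  have hchar : ∀ s t, muHat (ν s) t = ∫ x, expo (t * x) * ((max (s * h x) 0 : ℝ) : ℂ) ∂μ := by
    intro s t
    rw [muHat, integral_withDensity_eq_integral_toReal_smul₀ (by fun_prop) (by simp)]
    refine integral_congr_ae (Eventually.of_forall fun x => ?_)
    simp only [ENNReal.toReal_ofReal', Complex.real_smul]
    rw [mul_comm]
  have hint2 : ∀ s t, Integrable (fun x => expo (t * x) * ((max (s * h x) 0 : ℝ) : ℂ)) μ := by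
    intro s t
    refine (hint s).ofReal.bdd_mul (c := 1) (by fun_prop) (Eventually.of_forall fun x => ?_)
    exact (norm_expo _).le
  have heq : ν 1 = ν (-1) := by
    have := hfin 1
    have := hfin (-1)
    apply Measure.ext_of_charFun
    funext u
    have hu : u = 2 * Real.pi * (u / (2 * Real.pi)) := by field_simp
    rw [hu, ← muHat_eq_charFun, ← muHat_eq_charFun, hchar, hchar, ← sub_eq_zero,
      ← integral_sub (hint2 _ _) (hint2 _ _), ← h0 (u / (2 * Real.pi))]
    refine integral_congr_ae (Eventually.of_forall fun x => ?_)
    simp only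
    rw [← mul_sub, ← Complex.ofReal_sub]
    congr 2
    rcases le_total 0 (h x) with hx | hx
    · rw [max_eq_left (by linarith), max_eq_right (by linarith)]
      ring
    · rw [max_eq_right (by linarith), max_eq_left (by linarith)]
      ring
  have hae := (withDensity_eq_iff (by fun_prop) (by fun_prop) (by
    have := (hfin 1).measure_univ_lt_top
    rw [withDensity_apply _ MeasurableSet.univ, Measure.restrict_univ] at this
    exact this.ne)).1 heq
  filter_upwards [hae] with x hx
  rw [one_mul, neg_one_mul] at hx
  rcases le_total 0 (h x) with h1 | h1
  · rw [ENNReal.ofReal_of_nonpos (by linarith : -h x ≤ 0), ENNReal.ofReal_eq_zero] at hx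
    exact le_antisymm hx h1
  · rw [ENNReal.ofReal_of_nonpos h1, eq_comm, ENNReal.ofReal_eq_zero] at hx
    exact le_antisymm h1 (neg_nonpos.1 hx)

theorem eq_zero_of_inner_expLp_eq_zero {μ : Measure ℝ} [IsFiniteMeasure μ] (g : Lp ℂ 2 μ)
    (hg : ∀ t, inner ℂ (expLp μ t) g = 0) : g = 0 := by
  have hgi : Integrable (g : ℝ → ℂ) μ := (Lp.memLp g).integrable (by norm_num)
  have h1 : ∀ t, ∫ x, expo (t * x) * g x ∂μ = 0 := fun t => by
    have := hg (-t)
    rwa [inner_expLp_left, neg_neg] at this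
  -- Since t ranges over all of ℝ, the hypothesis is stable under conjugation, which lets real and
  -- imaginary parts be treated separately.
  have h2 : ∀ t, ∫ x, expo (t * x) * (starRingEnd ℂ) (g x) ∂μ = 0 := fun t => by
    have := congrArg (starRingEnd ℂ) (h1 (-t))
    rw [← integral_conj, map_zero] at this
    rw [← this]
    refine integral_congr_ae (Eventually.of_forall fun x => ?_)
    simp only [map_mul, conj_expo]
    rw [neg_mul, neg_neg]
  have hci : Integrable (fun x => (starRingEnd ℂ) (g x)) μ :=
    (LinearIsometryEquiv.integrable_comp_iff (Complex.conjLIE)).2 hgi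
  have hb : ∀ t {f : ℝ → ℂ}, Integrable f μ → Integrable (fun x => expo (t * x) * f x) μ := by
    intro t f hf
    exact hf.bdd_mul (c := 1) (by fun_prop) (Eventually.of_forall fun x => (norm_expo _).le)
  have hre := ae_eq_zero_of_integral_expo_mul_real hgi.re fun t => by
    have h3 : ∀ x, expo (t * x) * ((RCLike.re (g x) : ℝ) : ℂ) =
        (expo (t * x) * g x + expo (t * x) * (starRingEnd ℂ) (g x)) * (1 / 2) := by
      intro x
      change expo (t * x) * (((g x).re : ℝ) : ℂ) = _
      rw [Complex.re_eq_add_conj]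
      ring
    simp_rw [h3]
    rw [integral_mul_const, integral_add (hb t hgi) (hb t hci), h1, h2]
    simp
  have him := ae_eq_zero_of_integral_expo_mul_real hgi.im fun t => by
    have h3 : ∀ x, expo (t * x) * ((RCLike.im (g x) : ℝ) : ℂ) =
        (expo (t * x) * g x - expo (t * x) * (starRingEnd ℂ) (g x)) * (1 / (2 * Complex.I)) := by
      intro x
      change expo (t * x) * (((g x).im : ℝ) : ℂ) = _
      rw [Complex.im_eq_sub_conj]
      ring
    simp_rw [h3]
    rw [integral_mul_const, integral_sub (hb t hgi) (hb t hci), h1, h2]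
    simp
  rw [Lp.eq_zero_iff_ae_eq_zero]
  filter_upwards [hre, him] with x hx hy
  exact Complex.ext hx hy

/-! ### Extreme cycles -/

theorem exists_isExtremeCycle_of_periodic {N : ℕ} {B L : Finset ℤ} (x : ℕ → ℝ) (l : ℕ → ℤ) (k : ℕ)
    (hl : ∀ j ≤ k, l j ∈ L) (hx : ∀ j ≤ k, tau N (l j) (x j) = x (j + 1)) (hk : x (k + 1) = x 0)
    (hm : ∀ j ≤ k, ‖mask B (x j)‖ = 1) : ∃ C, IsExtremeCycle N B L C ∧ x 0 ∈ C := by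
  refine ⟨_, ⟨k, fun j => x j, fun j => l j, rfl, fun j => hl j (by omega), fun j => ?_,
    fun j => hm j (by omega)⟩, ⟨0, by simp⟩⟩
  rw [hx j (by omega)]
  change x (j + 1) = x ((j + 1 : Fin (k + 1)) : ℕ)
  rw [Fin.val_add_one]
  split_ifs with h
  · rw [h, Fin.val_last, hk]
  · rfl

/-- One step of the random walk with transition probabilities `|m_B(τ_ℓ x)|²`. -/
def MaskStep (N : ℕ) (B L : Finset ℤ) (x y : ℝ) : Prop :=
  ∃ l ∈ L, mask B (tau N l x) ≠ 0 ∧ tau N l x = y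

theorem exists_maskStep {N : ℕ} {B L : Finset ℤ} (h : IsHadamardTriple N B L) (x : ℝ) :
    ∃ y, MaskStep N B L x y := by
  by_contra! hne
  have h0 : ∀ l ∈ L, ‖mask B (tau N l x)‖ ^ 2 = 0 := fun l hl => by
    by_contra h1
    exact hne _ ⟨l, hl, fun h2 => h1 (by simp [h2]), rfl⟩
  have := h.sum_norm_mask_sq x
  rw [Finset.sum_eq_zero h0] at this
  exact zero_ne_one this

/-- For y = x this says (N^(k+1) − 1) x ∈ ℤ: recurrent points are rational with denominator coprime
to `N`. -/
theorem exists_pow_mul_eq_of_transGen {N : ℕ} {B L : Finset ℤ} (hN : N ≠ 0) {x y : ℝ}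
    (h : Relation.TransGen (MaskStep N B L) x y) :
    ∃ (k : ℕ) (c : ℤ), (N : ℝ) ^ (k + 1) * y = x + c := by
  have hN0 : (N : ℝ) ≠ 0 := by exact_mod_cast hN
  have hstep : ∀ {u v : ℝ}, MaskStep N B L u v → ∃ l : ℤ, (N : ℝ) * v = u + l := by
    rintro u v ⟨l, -, -, rfl⟩
    exact ⟨l, by unfold tau; field_simp⟩
  induction h with
  | single h =>
    obtain ⟨l, hl⟩ := hstep h
    exact ⟨0, l, by simpa using hl⟩
  | tail _ h ih =>
    obtain ⟨l, hl⟩ := hstep h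
    obtain ⟨k, c, hc⟩ := ih
    refine ⟨k + 1, c + N ^ (k + 1) * l, ?_⟩
    rw [pow_succ, mul_assoc, hl, mul_add, hc]
    push_cast
    ring

/-- Every non-empty finite set invariant under the random walk contains a point of an extreme
cycle. -/
theorem exists_isExtremeCycle_of_finite {N : ℕ} {B L : Finset ℤ} (h : IsHadamardTriple N B L)
    {E : Set ℝ} (hfin : E.Finite) (hne : E.Nonempty)
    (hE : ∀ x ∈ E, ∀ y, MaskStep N B L x y → y ∈ E) :
    ∃ x ∈ E, ∃ C, IsExtremeCycle N B L C ∧ x ∈ C := by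
  have hN := h.two_le
  let S : Set (Set ℝ) := {Y | Y ⊆ E ∧ Y.Nonempty ∧ ∀ x ∈ Y, ∀ y, MaskStep N B L x y → y ∈ Y}
  have hSfin : S.Finite := hfin.finite_subsets.subset fun Y hY => hY.1
  -- In a minimal invariant set every point is reachable from every other, in particular from
  -- itself.
  obtain ⟨Y, ⟨hYE, hYne, hY⟩, hmin⟩ := hSfin.exists_minimal ⟨E, subset_rfl, hne, hE⟩
  have hcyc : ∀ x ∈ Y, Relation.TransGen (MaskStep N B L) x x := by
    intro x hx
    let R : Set ℝ := {y | Relation.TransGen (MaskStep N B L) x y}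
    have hRY : R ⊆ Y := by
      intro y hy
      induction hy with
      | single h1 => exact hY _ hx _ h1
      | tail _ h1 ih => exact hY _ ih _ h1
    obtain ⟨y, hy⟩ := exists_maskStep h x
    have : Y ⊆ R := hmin ⟨hRY.trans hYE, ⟨y, .single hy⟩, fun u hu v hv => .tail hu hv⟩ hRY
    exact this hx
  have hden : ∀ x ∈ Y, ∃ m c : ℤ, IsCoprime m (N : ℤ) ∧ m * x = c := by
    intro x hx
    obtain ⟨k, c, hc⟩ := exists_pow_mul_eq_of_transGen (by omega) (hcyc x hx)
    refine ⟨N ^ (k + 1) - 1, c, ⟨-1, N ^ k, by ring⟩, ?_⟩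
    push_cast
    rw [sub_mul, hc]
    ring
  -- Two successors of x differ by (l − l')/N, while both have denominators coprime to `N`. Hence N
  -- divides l − l', which forces l = l'.
  have huniq : ∀ x ∈ Y, ∀ l ∈ L, ∀ l' ∈ L, mask B (tau N l x) ≠ 0 → mask B (tau N l' x) ≠ 0 →
      l = l' := by
    intro x hx l hl l' hl' hm hm'
    obtain ⟨m, c, hmN, hmc⟩ := hden _ (hY x hx _ ⟨l, hl, hm, rfl⟩)
    obtain ⟨m', c', hmN', hmc'⟩ := hden _ (hY x hx _ ⟨l', hl', hm', rfl⟩)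
    by_contra hll
    apply h.not_dvd_sub hl hl' hll
    have hN0 : (N : ℝ) ≠ 0 := by positivity
    have h1 : m * m' * (l - l') = N * (m' * c - m * c') := by
      have h2 : (m * m' * (l - l') : ℝ) = N * (m' * c - m * c') := by
        rw [← hmc, ← hmc']
        unfold tau
        field_simp
        ring
      exact_mod_cast h2
    exact (hmN.mul_left hmN').symm.dvd_of_dvd_mul_left ⟨_, h1⟩
  have hnext : ∀ x : Y, ∃ l : L, tau N l x ∈ Y ∧ ‖mask B (tau N l x)‖ = 1 := by
    rintro ⟨x, hx⟩
    obtain ⟨y, l, hl, hm, rfl⟩ := exists_maskStep h x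
    refine ⟨⟨l, hl⟩, hY x hx _ ⟨l, hl, hm, rfl⟩, ?_⟩
    -- Only one weight is nonzero and the weights sum to 1, so the step is taken with |m_B| = 1.
    have hsum := h.sum_norm_mask_sq x
    rw [Finset.sum_eq_single_of_mem l hl] at hsum
    · exact (pow_eq_one_iff_of_nonneg (norm_nonneg _) two_ne_zero).1 hsum
    · intro l' hl' hne'
      by_contra h0
      exact hne' (huniq x hx l' hl' l hl (fun h1 => h0 (by simp [h1])) hm)
  choose lab hlabY hlab1 using hnext
  let nxt : Y → Y := fun y => ⟨tau N (lab y) y, hlabY y⟩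
  obtain ⟨y0, hy0⟩ := hYne
  -- Starting after one step ensures that each `X n` is an image under `nxt`, where |m_B| = 1 is
  -- known.
  let X : ℕ → Y := fun n => nxt^[n + 1] ⟨y0, hy0⟩
  have hXs : ∀ n, tau N (lab (X n)) (X n) = X (n + 1) := fun n => by
    simp only [X]
    rw [Function.iterate_succ_apply' nxt (n + 1)]
  have hX1 : ∀ n, ‖mask B (X n)‖ = 1 := fun n => by
    simp only [X]
    rw [Function.iterate_succ_apply']
    exact hlab1 _
  have : Finite Y := hfin.subset hYE
  obtain ⟨i, j, hij, hXij⟩ := Finite.exists_ne_map_eq_of_infinite X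
  wlog hlt : i < j generalizing i j
  · exact this j i hij.symm hXij.symm (by omega)
  obtain ⟨k, rfl⟩ : ∃ k, j = i + (k + 1) := ⟨j - i - 1, by omega⟩
  refine ⟨X i, hYE (X i).2, ?_⟩
  exact exists_isExtremeCycle_of_periodic (fun n => (X (i + n) : ℝ)) (fun n => (lab (X (i + n)) : ℤ))
    k (fun n _ => (lab _).2) (fun n _ => hXs _) (by simp [← hXij]) (fun n _ => hX1 _)

/-! ### The canonical spectrum -/

section Spectrum

variable {N : ℕ} {B L : Finset ℤ}

theorem neg_mem_canonicalSpectrum {C : Set ℝ} (hC : IsExtremeCycle N B L C) {x : ℝ} (hx : x ∈ C) :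
    -x ∈ canonicalSpectrum N B L := fun _ hS => hS.1 C hC x hx

theorem mul_add_mem_canonicalSpectrum {s : ℝ} (hs : s ∈ canonicalSpectrum N B L) {l : ℤ}
    (hl : l ∈ L) : (N : ℝ) * s + l ∈ canonicalSpectrum N B L :=
  fun S hS => hS.2 s (hs S hS) l hl

theorem canonicalSpectrum_subset {S : Set ℝ}
    (h1 : ∀ C, IsExtremeCycle N B L C → ∀ x ∈ C, -x ∈ S)
    (h2 : ∀ s ∈ S, ∀ l ∈ L, (N : ℝ) * s + (l : ℝ) ∈ S) : canonicalSpectrum N B L ⊆ S :=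
  Set.sInter_subset_of_mem ⟨h1, h2⟩

theorem zero_mem_canonicalSpectrum (hB : B.Nonempty) (hL0 : (0 : ℤ) ∈ L) :
    (0 : ℝ) ∈ canonicalSpectrum N B L := by
  obtain ⟨C, hC, h0⟩ := exists_isExtremeCycle_of_periodic (N := N) (B := B) (L := L)
    (fun _ => 0) (fun _ => 0) 0 (fun _ _ => hL0) (fun _ _ => by simp [tau]) rfl
    (fun _ _ => by rw [mask_zero hB, norm_one])
  simpa using neg_mem_canonicalSpectrum hC h0

theorem IsExtremeCycle.mem_intDiv (hB : 2 ≤ B.card) (hB0 : (0 : ℤ) ∈ B) {C : Set ℝ}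
    (hC : IsExtremeCycle N B L C) {x : ℝ} (hx : x ∈ C) : x ∈ intDiv (B.gcd id) := by
  obtain ⟨k, y, l, rfl, -, -, hm⟩ := hC
  obtain ⟨j, rfl⟩ := hx
  exact (norm_mask_eq_one_iff hB hB0 _).1 (hm j)

theorem canonicalSpectrum_subset_intDiv (hB : 2 ≤ B.card) (hB0 : (0 : ℤ) ∈ B) :
    canonicalSpectrum N B L ⊆ intDiv (B.gcd id) := by
  refine canonicalSpectrum_subset (fun C hC x hx => intDiv_neg (hC.mem_intDiv hB hB0 hx))
    fun s hs l _ => ?_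
  exact intDiv_add (by simpa using intDiv_int_mul N hs)
    (int_mem_intDiv (gcd_ne_zero_of_two_le_card hB) l)

theorem countable_canonicalSpectrum (hB : 2 ≤ B.card) (hB0 : (0 : ℤ) ∈ B) :
    (canonicalSpectrum N B L).Countable :=
  (Set.countable_range _).mono (canonicalSpectrum_subset_intDiv hB hB0)

/-- By minimality of Λ: the elements having a predecessor in Λ already contain all −C and are closed
under s ↦ Ns + l. On a cycle, τ_l(x_j) = x_{j+1} reads −x_j = N(−x_{j+1}) + l. -/
theorem exists_eq_of_mem_canonicalSpectrum (hN : N ≠ 0) {s : ℝ}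
    (hs : s ∈ canonicalSpectrum N B L) :
    ∃ u ∈ canonicalSpectrum N B L, ∃ l ∈ L, (N : ℝ) * u + (l : ℝ) = s := by
  have hN0 : (N : ℝ) ≠ 0 := by exact_mod_cast hN
  let S : Set ℝ := {s | s ∈ canonicalSpectrum N B L ∧
    ∃ u ∈ canonicalSpectrum N B L, ∃ l ∈ L, (N : ℝ) * u + (l : ℝ) = s}
  have : canonicalSpectrum N B L ⊆ S := by
    refine canonicalSpectrum_subset (fun C hC x hx => ?_) fun s hs l hl =>
      ⟨mul_add_mem_canonicalSpectrum hs.1 hl, s, hs.1, l, hl, rfl⟩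
    refine ⟨neg_mem_canonicalSpectrum hC hx, ?_⟩
    have hC' := hC
    obtain ⟨k, y, l, rfl, hl, hy, -⟩ := hC'
    obtain ⟨j, rfl⟩ := hx
    refine ⟨-y (j + 1), neg_mem_canonicalSpectrum hC ⟨j + 1, rfl⟩, l j, hl j, ?_⟩
    rw [← hy j]
    unfold tau
    field_simp
    ring
  exact (this hs).2

theorem IsHadamardTriple.digit_unique (h : IsHadamardTriple N B L) {s s' : ℝ}
    (hs : s ∈ intDiv (B.gcd id)) (hs' : s' ∈ intDiv (B.gcd id)) {l l' : ℤ} (hl : l ∈ L)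
    (hl' : l' ∈ L) (heq : (N : ℝ) * s + l = N * s' + l') : s = s' ∧ l = l' := by
  have hN0 : (N : ℝ) ≠ 0 := by
    have := h.two_le
    positivity
  have hll : l = l' := by
    by_contra hne
    have h0 := h.mask_sub_div hl hl' hne
    have h1 : ((l : ℝ) - l') / N = 0 + (s' - s) := by
      rw [div_eq_iff hN0]
      linarith
    rw [h1, mask_add_of_mem_intDiv h.two_le_card (intDiv_sub hs' hs), mask_zero] at h0
    · exact one_ne_zero h0
    · exact Finset.card_pos.1 (by have := h.two_le_card; omega)
  subst hll
  exact ⟨mul_left_cancel₀ hN0 (by linarith), rfl⟩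

/-- Compare last digits using μ̂(t) = m_B(t/N) μ̂(t/N). Equal digits cancel and the difference
shrinks by the factor N; distinct digits make the mask factor vanish, by ℤ/d-periodicity and the
Hadamard condition. -/
theorem IsHadamardTriple.muHat_sub_eq_zero (h : IsHadamardTriple N B L) (hB0 : (0 : ℤ) ∈ B)
    {μ : Measure ℝ} (hμ : IsSelfSimilarMeasure N B μ) {s s' : ℝ}
    (hs : s ∈ canonicalSpectrum N B L) (hs' : s' ∈ canonicalSpectrum N B L) (hne : s ≠ s') :
    muHat μ (s - s') = 0 := by
  have hN := h.two_le
  have h2 : (2 : ℝ) ≤ N := by exact_mod_cast hN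
  have hN0 : (N : ℝ) ≠ 0 := by positivity
  have hsub := canonicalSpectrum_subset_intDiv (N := N) (L := L) h.two_le_card hB0
  have hd := gcd_ne_zero_of_two_le_card h.two_le_card
  set d := B.gcd id with hdd
  -- The induction terminates because d(s − s') is an integer: once below 1 in absolute value it is
  -- 0, contradicting s ≠ s'.
  have key : ∀ n : ℕ, ∀ s ∈ canonicalSpectrum N B L, ∀ s' ∈ canonicalSpectrum N B L, s ≠ s' →
      |(d : ℝ) * (s - s')| < (N : ℝ) ^ n → muHat μ (s - s') = 0 := by
    intro n
    induction n with
    | zero =>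
      intro s hs s' hs' hne hlt
      obtain ⟨k, hk⟩ := (mem_intDiv_iff hd _).1 (intDiv_sub (hsub hs) (hsub hs'))
      rw [hk, pow_zero] at hlt
      have hk0 : k = 0 := Int.abs_lt_one_iff.1 (by exact_mod_cast hlt)
      rw [hk0, Int.cast_zero, mul_eq_zero, Int.cast_eq_zero] at hk
      exact absurd (sub_eq_zero.1 (hk.resolve_left hd)) hne
    | succ n ih =>
      intro s hs s' hs' hne hlt
      obtain ⟨u, hu, l, hl, rfl⟩ := exists_eq_of_mem_canonicalSpectrum (by omega) hs
      obtain ⟨u', hu', l', hl', rfl⟩ := exists_eq_of_mem_canonicalSpectrum (by omega) hs'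
      rw [hμ.muHat_eq]
      by_cases hll : l = l'
      · subst hll
        have h1 : ((N : ℝ) * u + l - (N * u' + l)) / N = u - u' := by
          field_simp
          ring
        rw [h1, ih u hu u' hu' (fun h => hne (by rw [h])), mul_zero]
        have h3 : (d : ℝ) * (N * u + l - (N * u' + l)) = N * (d * (u - u')) := by ring
        rw [h3, abs_mul, Nat.abs_cast, pow_succ'] at hlt
        exact lt_of_mul_lt_mul_left hlt (by positivity)
      · have h1 : ((N : ℝ) * u + l - (N * u' + l')) / N = ((l : ℝ) - l') / N + (u - u') := by
          field_simp
          ring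
        have h3 : mask B (((N : ℝ) * u + l - (N * u' + l')) / N) = 0 := by
          rw [h1, mask_add_of_mem_intDiv h.two_le_card (intDiv_sub (hsub hu) (hsub hu')),
            h.mask_sub_div hl hl' hll]
        rw [h3, zero_mul]
  obtain ⟨n, hn⟩ := pow_unbounded_of_one_lt |(d : ℝ) * (s - s')| (by linarith : (1 : ℝ) < N)
  exact key n s hs s' hs' hne hn

theorem IsHadamardTriple.orthonormal_expLp (h : IsHadamardTriple N B L) (hB0 : (0 : ℤ) ∈ B)
    {μ : Measure ℝ} [IsProbabilityMeasure μ] (hμ : IsSelfSimilarMeasure N B μ) :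
    Orthonormal ℂ fun s : canonicalSpectrum N B L => expLp μ (s : ℝ) := by
  refine ⟨fun s => norm_expLp μ _, fun s s' hne => ?_⟩
  change inner ℂ (expLp μ (s : ℝ)) (expLp μ (s' : ℝ)) = 0
  rw [inner_expLp]
  exact h.muHat_sub_eq_zero hB0 hμ s'.2 s.2 fun h => hne (Subtype.ext h.symm)

end Spectrum

/-! ### The analysis operator of an orthonormal family -/

section Analysis

variable {ι E : Type*} [NormedAddCommGroup E] [InnerProductSpace ℂ E] [CompleteSpace E] {v : ι → E}

/-- The analysis operator `w ↦ (⟪v i, w⟫)_i` of an orthonormal family. -/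
noncomputable def analysisOp (hv : Orthonormal ℂ v) : E →L[ℂ] lp (fun _ : ι => ℂ) 2 :=
  ContinuousLinearMap.adjoint hv.orthogonalFamily.linearIsometry.toContinuousLinearMap

theorem analysisOp_apply (hv : Orthonormal ℂ v) (w : E) (i : ι) :
    analysisOp hv w i = inner ℂ (v i) w := by
  classical
  have h1 := lp.inner_single_left (𝕜 := ℂ) i (1 : ℂ) (analysisOp hv w)
  rw [analysisOp, ContinuousLinearMap.adjoint_inner_right] at h1
  have h2 : hv.orthogonalFamily.linearIsometry.toContinuousLinearMap (lp.single 2 i (1 : ℂ)) =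
      v i := by
    change hv.orthogonalFamily.linearIsometry (lp.single 2 i (1 : ℂ)) = v i
    rw [OrthogonalFamily.linearIsometry_apply_single]
    simp
  rw [h2] at h1
  rw [h1]
  simp [analysisOp]

theorem hasSum_norm_analysisOp (hv : Orthonormal ℂ v) (w : E) :
    HasSum (fun i => ‖inner ℂ (v i) w‖ ^ 2) (‖analysisOp hv w‖ ^ 2) := by
  have h := lp.hasSum_norm (p := 2) (by norm_num) (analysisOp hv w)
  simp only [ENNReal.toReal_ofNat, Real.rpow_ofNat, analysisOp_apply] at h
  exact h

theorem norm_analysisOp_le (hv : Orthonormal ℂ v) (w : E) : ‖analysisOp hv w‖ ≤ ‖w‖ := by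
  refine (sq_le_sq₀ (norm_nonneg _) (norm_nonneg _)).1 ?_
  rw [← (hasSum_norm_analysisOp hv w).tsum_eq]
  exact hv.tsum_inner_products_le w

/-- Equality in Bessel's inequality puts w in the range of the synthesis isometry U, as ‖w − UU*w‖²
= ‖w‖² − ‖U*w‖². A vector orthogonal to every v i is orthogonal to that range. -/
theorem inner_eq_zero_of_norm_analysisOp (hv : Orthonormal ℂ v) {w g : E}
    (hw : ‖analysisOp hv w‖ = ‖w‖) (hg : ∀ i, inner ℂ (v i) g = 0) : inner ℂ w g = 0 := by
  set U := hv.orthogonalFamily.linearIsometry.toContinuousLinearMap with hU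
  have hUn : ∀ z, ‖U z‖ = ‖z‖ := fun z => hv.orthogonalFamily.linearIsometry.norm_map z
  have h1 : w = U (analysisOp hv w) := by
    rw [← sub_eq_zero, ← norm_eq_zero, ← sq_eq_zero_iff, @norm_sub_sq ℂ, hUn, hw,
      ← ContinuousLinearMap.adjoint_inner_left]
    change ‖w‖ ^ 2 - 2 * RCLike.re (inner ℂ (analysisOp hv w) (analysisOp hv w)) + ‖w‖ ^ 2 = 0
    rw [inner_self_eq_norm_sq, hw]
    ring
  have h2 : analysisOp hv g = 0 := by
    ext i
    rw [analysisOp_apply, hg]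
    rfl
  rw [h1, ← ContinuousLinearMap.adjoint_inner_right]
  change inner ℂ _ (analysisOp hv g) = 0
  rw [h2, inner_zero_right]

end Analysis

/-! ### Completeness of the canonical spectrum -/

section Completeness

variable {N : ℕ} {B L : Finset ℤ}

/-- The function `x ↦ ∑_{λ ∈ Λ} |μ̂(x + λ)|²`. -/
noncomputable def spectralSum (μ : Measure ℝ) (Λ : Set ℝ) (x : ℝ) : ℝ :=
  ∑' s : Λ, ‖muHat μ (x + s)‖ ^ 2

theorem hasSum_spectralSum {μ : Measure ℝ} [IsProbabilityMeasure μ] {Λ : Set ℝ}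
    (hv : Orthonormal ℂ fun s : Λ => expLp μ (s : ℝ)) (x : ℝ) :
    HasSum (fun s : Λ => ‖muHat μ (x + s)‖ ^ 2) (‖analysisOp hv (expLp μ (-x))‖ ^ 2) := by
  convert hasSum_norm_analysisOp hv (expLp μ (-x)) using 3 with s
  rw [inner_expLp, ← norm_muHat_neg]
  ring_nf

theorem spectralSum_eq {μ : Measure ℝ} [IsProbabilityMeasure μ] {Λ : Set ℝ}
    (hv : Orthonormal ℂ fun s : Λ => expLp μ (s : ℝ)) (x : ℝ) :
    spectralSum μ Λ x = ‖analysisOp hv (expLp μ (-x))‖ ^ 2 :=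
  (hasSum_spectralSum hv x).tsum_eq

theorem spectralSum_le_one {μ : Measure ℝ} [IsProbabilityMeasure μ] {Λ : Set ℝ}
    (hv : Orthonormal ℂ fun s : Λ => expLp μ (s : ℝ)) (x : ℝ) : spectralSum μ Λ x ≤ 1 := by
  rw [spectralSum_eq hv]
  have := norm_analysisOp_le hv (expLp μ (-x))
  rw [norm_expLp] at this
  exact pow_le_one₀ (norm_nonneg _) this

theorem spectralSum_eq_one_of_neg_mem {μ : Measure ℝ} [IsProbabilityMeasure μ] {Λ : Set ℝ}
    (hv : Orthonormal ℂ fun s : Λ => expLp μ (s : ℝ)) {x : ℝ} (hx : -x ∈ Λ) :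
    spectralSum μ Λ x = 1 := by
  refine le_antisymm (spectralSum_le_one hv x) ?_
  have := (hasSum_spectralSum hv x).summable.le_tsum (⟨-x, hx⟩ : Λ) fun _ _ => by positivity
  rw [add_neg_cancel, muHat_zero, norm_one, one_pow] at this
  exact this

theorem analyticOnNhd_spectralSum {μ : Measure ℝ} [IsProbabilityMeasure μ] {Λ : Set ℝ}
    (hv : Orthonormal ℂ fun s : Λ => expLp μ (s : ℝ)) {M : ℝ} (hM : ∀ᵐ x ∂μ, |x| ≤ M) :
    AnalyticOnNhd ℝ (spectralSum μ Λ) Set.univ := by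
  have hfun : spectralSum μ Λ = fun x => ‖analysisOp hv (expLp μ (-x))‖ ^ 2 :=
    funext (spectralSum_eq hv)
  rw [hfun]
  have h1 : AnalyticOnNhd ℝ (fun x : ℝ => expLp μ (-x)) Set.univ := fun x _ =>
    AnalyticAt.fun_comp (g := expLp μ) (f := fun x : ℝ => -x)
      (analyticOnNhd_expLp hM (-x) trivial) (by fun_prop)
  have h2 : AnalyticOnNhd ℝ (fun x : ℝ => analysisOp hv (expLp μ (-x))) Set.univ := fun x _ =>
    AnalyticAt.fun_comp (g := (analysisOp hv).restrictScalars ℝ) (f := fun x : ℝ => expLp μ (-x))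
      (ContinuousLinearMap.analyticAt _ _) (h1 x trivial)
  -- The exponent `⊤` is ω, so this is analyticity and not merely C^∞.
  have h3 : ContDiff ℝ ⊤ fun x : ℝ => ‖analysisOp hv (expLp μ (-x))‖ ^ 2 :=
    ContDiff.norm_sq ℂ (contDiffOn_univ.1 (h2.contDiffOn uniqueDiffOn_univ))
  exact isOpen_univ.analyticOn_iff_analyticOnNhd.1 h3.contDiffOn.analyticOn

/-- Each element of Λ is Nλ + l for exactly one pair (λ, l). Sum over l last, apply the refinement
equation of μ̂, and drop λ from the mask by ℤ/d-periodicity. -/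
theorem IsHadamardTriple.spectralSum_eq_sum (h : IsHadamardTriple N B L) (hB0 : (0 : ℤ) ∈ B)
    {μ : Measure ℝ} [IsProbabilityMeasure μ] (hμ : IsSelfSimilarMeasure N B μ) (x : ℝ) :
    spectralSum μ (canonicalSpectrum N B L) x =
      ∑ l ∈ L, ‖mask B (tau N l x)‖ ^ 2 *
        spectralSum μ (canonicalSpectrum N B L) (tau N l x) := by
  set Λ := canonicalSpectrum N B L with hΛ
  have hv := h.orthonormal_expLp hB0 hμ
  have hN := h.two_le
  have hN0 : (N : ℝ) ≠ 0 := by positivity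
  have hsub := canonicalSpectrum_subset_intDiv (N := N) (L := L) h.two_le_card hB0
  let e : Λ × L → Λ := fun p =>
    ⟨N * (p.1 : ℝ) + (p.2 : ℤ), mul_add_mem_canonicalSpectrum p.1.2 p.2.2⟩
  have he : Function.Bijective e := by
    constructor
    · rintro ⟨s, l⟩ ⟨s', l'⟩ heq
      have := h.digit_unique (hsub s.2) (hsub s'.2) l.2 l'.2 (congrArg Subtype.val heq)
      exact Prod.ext (Subtype.ext this.1) (Subtype.ext this.2)
    · rintro ⟨s, hs⟩
      obtain ⟨u, hu, l, hl, hul⟩ := exists_eq_of_mem_canonicalSpectrum (by omega) hs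
      exact ⟨(⟨u, hu⟩, ⟨l, hl⟩), Subtype.ext hul⟩
  have hterm : ∀ p : Λ × L, ‖muHat μ (x + e p)‖ ^ 2 =
      ‖mask B (tau N p.2 x)‖ ^ 2 * ‖muHat μ (tau N p.2 x + p.1)‖ ^ 2 := by
    rintro ⟨s, l⟩
    rw [hμ.muHat_eq]
    have h1 : (x + e (s, l)) / N = tau N l x + s := by
      simp only [e, tau]
      field_simp
      ring
    rw [h1, mask_add_of_mem_intDiv h.two_le_card (hsub s.2), norm_mul, mul_pow]
  have hsum : Summable fun p : Λ × L => ‖muHat μ (x + e p)‖ ^ 2 :=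
    (Equiv.ofBijective e he).summable_iff.2 (hasSum_spectralSum hv x).summable
  have h1 : spectralSum μ Λ x = ∑' p : Λ × L, ‖muHat μ (x + e p)‖ ^ 2 :=
    ((Equiv.ofBijective e he).tsum_eq fun s : Λ => ‖muHat μ (x + s)‖ ^ 2).symm
  rw [h1, hsum.tsum_prod, ← Finset.sum_coe_sort L]
  simp only [tsum_fintype, hterm]
  rw [Summable.tsum_finsetSum]
  · exact Finset.sum_congr rfl fun l _ => tsum_mul_left
  · exact fun l _ => (hasSum_spectralSum hv _).summable.mul_left _

theorem eq_const_of_infinite_of_analyticOnNhd {f : ℝ → ℝ} (hf : AnalyticOnNhd ℝ f Set.univ)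
    {K : Set ℝ} (hK : IsCompact K) {c : ℝ} (hinf : {x | x ∈ K ∧ f x = c}.Infinite) (x : ℝ) :
    f x = c := by
  obtain ⟨z, -, hz⟩ := hinf.exists_accPt_of_subset_isCompact hK fun x hx => hx.1
  have hfr : ∃ᶠ y in 𝓝[≠] z, f y = (fun _ => c) y :=
    (accPt_iff_frequently_nhdsNE.1 hz).mono fun y hy => hy.2
  exact congrFun (hf.eq_of_frequently_eq (fun _ _ => analyticAt_const) hfr) x

theorem IsHadamardTriple.spectralSum_eq_one (h : IsHadamardTriple N B L) (hB0 : (0 : ℤ) ∈ B)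
    (hL0 : (0 : ℤ) ∈ L) {μ : Measure ℝ} [IsProbabilityMeasure μ]
    (hμ : IsSelfSimilarMeasure N B μ) (x : ℝ) :
    spectralSum μ (canonicalSpectrum N B L) x = 1 := by
  set F := spectralSum μ (canonicalSpectrum N B L) with hF
  have hv := h.orthonormal_expLp hB0 hμ
  have h2 : (2 : ℝ) ≤ N := by exact_mod_cast h.two_le
  obtain ⟨R, hR⟩ := exists_digit_bound B
  have hana := analyticOnNhd_spectralSum hv (hμ.ae_abs_le h.two_le ⟨0, hB0⟩ hR)
  have hone : ∀ {y : ℝ}, -y ∈ canonicalSpectrum N B L → F y = 1 :=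
    fun hy => spectralSum_eq_one_of_neg_mem hv hy
  have hF0 : F 0 = 1 := hone (by simpa using zero_mem_canonicalSpectrum ⟨0, hB0⟩ hL0)
  obtain ⟨M', hM'⟩ := exists_digit_bound L
  -- As N ≥ 2, every τ_l maps [−M, M] into itself once M bounds |l|; the added 1 keeps the interval
  -- nondegenerate, hence infinite.
  let M : ℝ := |M'| + 1
  have hM1 : 0 < M := by positivity
  have hM : ∀ l ∈ L, |(l : ℝ)| ≤ M := fun l hl =>
    (hM' l hl).trans ((le_abs_self _).trans (by simp [M]))
  have htau : ∀ y ∈ Set.Icc (-M) M, ∀ l ∈ L, tau N l y ∈ Set.Icc (-M) M := by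
    intro y hy l hl
    have h3 := abs_le.1 (hM l hl)
    have h4 : (0 : ℝ) < N := by linarith
    unfold tau
    rw [Set.mem_Icc, le_div_iff₀ h4, div_le_iff₀ h4]
    constructor <;> nlinarith [hy.1, hy.2, h3.1, h3.2]
  obtain ⟨z, hz, hzmin⟩ := (isCompact_Icc (a := -M) (b := M)).exists_isMinOn
    ⟨0, by simp [hM1.le]⟩ (hana.continuousOn.mono (Set.subset_univ _))
  have hmin : ∀ y ∈ Set.Icc (-M) M, F z ≤ F y := fun y hy => hzmin hy
  let E : Set ℝ := {y | y ∈ Set.Icc (-M) M ∧ F y = F z}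
  have hz1 : F z = 1 := by
    by_cases hfin : E.Finite
    · obtain ⟨y, hyE, C, hC, hyC⟩ := exists_isExtremeCycle_of_finite h hfin ⟨z, hz, rfl⟩ (by
        rintro y ⟨hy, hyc⟩ _ ⟨l, hl, hml, rfl⟩
        refine ⟨htau y hy l hl, le_antisymm ?_ (hmin _ (htau y hy l hl))⟩
        -- F(y) is a weighted average of values that are at least F(z); if y is a minimum point, no
        -- value of positive weight can exceed F(z).
        by_contra! hlt
        have hsum : F y = ∑ k ∈ L, ‖mask B (tau N k y)‖ ^ 2 * F (tau N k y) :=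
          h.spectralSum_eq_sum hB0 hμ y
        have hlt2 : ∑ k ∈ L, ‖mask B (tau N k y)‖ ^ 2 * F z <
            ∑ k ∈ L, ‖mask B (tau N k y)‖ ^ 2 * F (tau N k y) := by
          refine Finset.sum_lt_sum (fun k hk => ?_) ⟨l, hl, ?_⟩
          · exact mul_le_mul_of_nonneg_left (hmin _ (htau y hy k hk)) (by positivity)
          · exact mul_lt_mul_of_pos_left hlt (by positivity)
        rw [← Finset.sum_mul, h.sum_norm_mask_sq, one_mul, ← hsum, hyc] at hlt2
        exact lt_irrefl _ hlt2)
      rw [← hyE.2]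
      exact hone (neg_mem_canonicalSpectrum hC hyC)
    · rw [← eq_const_of_infinite_of_analyticOnNhd hana isCompact_Icc hfin 0]
      exact hF0
  refine eq_const_of_infinite_of_analyticOnNhd hana (isCompact_Icc (a := -M) (b := M)) ?_ x
  refine (Set.Icc_infinite (by linarith : -M < M)).mono fun y hy => ⟨hy, ?_⟩
  exact le_antisymm (spectralSum_le_one hv y) (hz1 ▸ hmin y hy)

/-- The canonical spectrum of a Hadamard triple is a spectrum of the self-similar measure. -/
theorem IsHadamardTriple.isSpectralPair (h : IsHadamardTriple N B L) (hB0 : (0 : ℤ) ∈ B)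
    (hL0 : (0 : ℤ) ∈ L) :
    IsSpectralPair (selfSimilarMeasure N B) (canonicalSpectrum N B L) := by
  have hμ := isSelfSimilarMeasure_selfSimilarMeasure h.two_le ⟨0, hB0⟩
  set μ := selfSimilarMeasure N B
  have := hμ.isProbabilityMeasure
  have hv := h.orthonormal_expLp hB0 hμ
  refine ⟨this, countable_canonicalSpectrum h.two_le_card hB0,
    HilbertBasis.mkOfOrthogonalEqBot hv ?_, fun s => ?_⟩
  · rw [Submodule.eq_bot_iff]
    intro g hg
    rw [Submodule.mem_orthogonal] at hg
    refine eq_zero_of_inner_expLp_eq_zero g fun t => inner_eq_zero_of_norm_analysisOp hv ?_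
      fun s => hg _ (Submodule.subset_span ⟨s, rfl⟩)
    have h1 := h.spectralSum_eq_one hB0 hL0 hμ (-t)
    rw [spectralSum_eq hv, neg_neg] at h1
    rw [norm_expLp]
    exact (pow_eq_one_iff_of_nonneg (norm_nonneg _) two_ne_zero).1 h1
  · rw [HilbertBasis.coe_mkOfOrthogonalEqBot]
    filter_upwards [coeFn_expLp μ (s : ℝ)] with x hx
    rw [hx, expo]
    push_cast
    ring_nf

end Completeness

/-! ### Spectral pairs are maximal -/

/-- A further member of the orthonormal family would be orthogonal to a basis, hence zero, although
it has norm 1. -/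
theorem _root_.HilbertBasis.mem_range_of_orthonormal {ι κ E : Type*} [NormedAddCommGroup E]
    [InnerProductSpace ℂ E] (e : HilbertBasis ι ℂ E) {f : κ → E} (hf : Orthonormal ℂ f) {g : ι → κ}
    (hef : ∀ i, e i = f (g i)) (j : κ) : j ∈ Set.range g := by
  by_contra hj
  have hzero : e.repr (f j) = 0 := by
    ext i
    rw [e.repr_apply_apply, hef, hf.2 fun h => hj ⟨i, h⟩]
    rfl
  have h1 := hf.1 j
  rw [e.repr.map_eq_zero_iff.1 hzero, norm_zero] at h1
  exact zero_ne_one h1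

theorem IsSpectralPair.eq_of_subset {μ : Measure ℝ} {Γ Λ : Set ℝ} (hΓ : IsSpectralPair μ Γ)
    (hΛ : IsSpectralPair μ Λ) (hsub : Γ ⊆ Λ) : Γ = Λ := by
  obtain ⟨e, he⟩ := hΓ.exists_basis
  obtain ⟨f, hf⟩ := hΛ.exists_basis
  have hef : ∀ s : Γ, e s = f (Set.inclusion hsub s) := fun s =>
    Lp.ext ((he s).trans (hf (Set.inclusion hsub s)).symm)
  refine hsub.antisymm fun t ht => ?_
  obtain ⟨s, hs⟩ := e.mem_range_of_orthonormal f.orthonormal hef ⟨t, ht⟩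
  have hst : (s : ℝ) = t := congrArg Subtype.val hs
  exact hst ▸ s.2

/-! ### The attractor -/

section Attractor

variable {N : ℕ} {A : Finset ℤ}

/-- A bounded set in which every point is the image of another one under some `τ_a` lies in the
attractor. -/
theorem subset_attractor (hN : 2 ≤ N) {Y : Set ℝ} (hY : Bornology.IsBounded Y)
    (hstep : ∀ y ∈ Y, ∃ a ∈ A, ∃ z ∈ Y, tau N a z = y) : Y ⊆ attractor N A := by
  have hN0 : (N : ℝ) ≠ 0 := by positivity
  intro x hx
  have hstep' : ∀ y : Y, ∃ c : A, ∃ z : Y, tau N c z = y := by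
    rintro ⟨y, hy⟩
    obtain ⟨a, ha, z, hz, h⟩ := hstep y hy
    exact ⟨⟨a, ha⟩, ⟨z, hz⟩, h⟩
  choose c z hz using hstep'
  let X : ℕ → Y := fun n => z^[n] ⟨x, hx⟩
  have hX : ∀ n, (X n : ℝ) = tau N (c (X n)) (X (n + 1)) := by
    intro n
    rw [← hz (X n)]
    simp only [X, Function.iterate_succ_apply']
  have hx_eq : ∀ n, x - (X n : ℝ) / (N : ℝ) ^ n =
      ∑ k ∈ Finset.range n, ((c (X k) : ℤ) : ℝ) / (N : ℝ) ^ (k + 1) := by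
    intro n
    induction n with
    | zero => simp [X]
    | succ n ih =>
      rw [Finset.sum_range_succ, ← ih, hX n]
      unfold tau
      field_simp
      ring
  obtain ⟨R, hR⟩ := hY.exists_norm_le
  have hlim0 : Tendsto (fun n => (X n : ℝ) / (N : ℝ) ^ n) atTop (𝓝 0) := by
    refine squeeze_zero_norm (fun n => ?_) (tendsto_inv_pow hN R)
    rw [norm_div, norm_pow, Real.norm_natCast]
    gcongr
    exact hR _ (X n).2
  have hlim := tendsto_const_nhds (x := x).sub hlim0
  simp only [hx_eq, sub_zero] at hlim
  exact ⟨fun k => c (X k), tendsto_nhds_unique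
    (summable_coding hN fun k => c (X k)).hasSum.tendsto_sum_nat hlim⟩

theorem finite_attractor_inter_intDiv (hN : 2 ≤ N) {d : ℤ} (hd : d ≠ 0) :
    (attractor N A ∩ intDiv d).Finite := by
  have hbdd : Bornology.IsBounded (attractor N A) :=
    (isCompact_range (continuous_coding hN)).isBounded
  obtain ⟨R, hR⟩ := hbdd.exists_norm_le
  have hd0 : 0 < |(d : ℝ)| := by
    rw [abs_pos]
    exact_mod_cast hd
  refine ((Set.finite_Icc (-⌈R * |(d : ℝ)|⌉) ⌈R * |(d : ℝ)|⌉).image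
    fun k : ℤ => (k : ℝ) / d).subset ?_
  rintro _ ⟨hx, k, rfl⟩
  refine ⟨k, ?_, rfl⟩
  have h1 := hR _ hx
  simp only [norm_div, Real.norm_eq_abs] at h1
  rw [div_le_iff₀ hd0] at h1
  have h2 : ((|k| : ℤ) : ℝ) ≤ ((⌈R * |(d : ℝ)|⌉ : ℤ) : ℝ) := by
    push_cast
    exact h1.trans (Int.le_ceil _)
  exact abs_le.1 (by exact_mod_cast h2)

end Attractor

/-! ### Scaling by an integer coprime to `N` -/

section Scaling

variable {N q : ℕ} {B L : Finset ℤ}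

theorem intDiv_subset_mul {d : ℤ} (hd : d ≠ 0) (hq : q ≠ 0) : intDiv d ⊆ intDiv ((q : ℤ) * d) := by
  intro x hx
  obtain ⟨k, hk⟩ := (mem_intDiv_iff hd x).1 hx
  refine (mem_intDiv_iff (mul_ne_zero (by exact_mod_cast hq) hd) x).2 ⟨q * k, ?_⟩
  push_cast
  rw [mul_assoc, hk]

theorem mem_intDiv_mul_iff {d : ℤ} (hd : d ≠ 0) (hq : q ≠ 0) (x : ℝ) :
    x ∈ intDiv ((q : ℤ) * d) ↔ (q : ℝ) * x ∈ intDiv d := by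
  rw [mem_intDiv_iff hd, mem_intDiv_iff (mul_ne_zero (by exact_mod_cast hq) hd)]
  refine exists_congr fun k => ?_
  push_cast
  rw [mul_comm (q : ℝ), mul_assoc]

/-- Since `q` is coprime to `N`, the maps `τ_a` cannot take a point of `ℤ/d` to a point of
`ℤ/(qd)` outside `ℤ/d`. -/
theorem mem_intDiv_of_tau {d : ℤ} (hd : d ≠ 0) (hN : N ≠ 0) (hqN : Nat.gcd q N = 1) (hq : q ≠ 0)
    {a : ℤ} {x : ℝ} (hx : x ∈ intDiv d) (hτ : tau N a x ∈ intDiv ((q : ℤ) * d)) :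
    tau N a x ∈ intDiv d := by
  have hN0 : (N : ℝ) ≠ 0 := by exact_mod_cast hN
  have h1 : ((N : ℤ) : ℝ) * tau N a x ∈ intDiv d := by
    have : ((N : ℤ) : ℝ) * tau N a x = x + a := by
      unfold tau
      push_cast
      field_simp
    rw [this]
    exact intDiv_add hx (int_mem_intDiv hd a)
  have h2 := (mem_intDiv_mul_iff hd hq _).1 hτ
  obtain ⟨u, v, huv⟩ := (Nat.isCoprime_iff_coprime (m := q) (n := N)).2 hqN
  have h3 : tau N a x = u * (q * tau N a x) + v * ((N : ℤ) * tau N a x) := by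
    have : (u * q + v * N : ℝ) = 1 := by exact_mod_cast huv
    calc tau N a x = (u * q + v * N : ℝ) * tau N a x := by rw [this, one_mul]
      _ = _ := by push_cast; ring
  rw [h3]
  exact intDiv_add (intDiv_int_mul u h2) (intDiv_int_mul v h1)

theorem tau_mul (a : ℤ) (x : ℝ) : tau N (q * a) (q * x) = q * tau N a x := by
  unfold tau
  push_cast
  ring

theorem mul_image_canonicalSpectrum_subset (hB : 2 ≤ B.card) (hB0 : (0 : ℤ) ∈ B) :
    (fun x : ℝ => (q : ℝ) * x) '' canonicalSpectrum N B L ⊆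
      canonicalSpectrum N B (L.image fun l => (q : ℤ) * l) := by
  rw [Set.image_subset_iff]
  refine canonicalSpectrum_subset (fun C hC x hx => ?_) fun s hs l hl => ?_
  · obtain ⟨k, y, l, rfl, hl, hy, hm⟩ := hC
    obtain ⟨j, rfl⟩ := hx
    have hC' : IsExtremeCycle N B (L.image fun l => (q : ℤ) * l)
        (Set.range fun i => (q : ℝ) * y i) := by
      refine ⟨k, _, fun i => q * l i, rfl, fun i => Finset.mem_image_of_mem _ (hl i), fun i => ?_,
        fun i => ?_⟩
      · rw [tau_mul, hy]
      · rw [norm_mask_eq_one_iff hB hB0]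
        simpa using intDiv_int_mul q ((norm_mask_eq_one_iff hB hB0 _).1 (hm i))
    have := neg_mem_canonicalSpectrum hC' ⟨j, rfl⟩
    simpa using this
  · have := mul_add_mem_canonicalSpectrum hs (Finset.mem_image_of_mem (fun l => (q : ℤ) * l) hl)
    have h1 : (q : ℝ) * (N * s + l) = N * (q * s) + ((q * l : ℤ) : ℝ) := by
      push_cast
      ring
    change (q : ℝ) * (N * s + l) ∈ canonicalSpectrum N B (L.image fun l => (q : ℤ) * l)
    rw [h1]
    exact this

/-- An extreme cycle for qL divided by q is a cycle of the maps for L, so it lies in K, and its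
points lie in ℤ/(qd). Then `hK` moves it into ℤ/d, which makes it extreme for L. -/
theorem canonicalSpectrum_image_mul_subset (hN : 2 ≤ N) (hB : 2 ≤ B.card) (hB0 : (0 : ℤ) ∈ B)
    (hq : q ≠ 0)
    (hK : attractor N L ∩ intDiv ((q : ℤ) * B.gcd id) ⊆ intDiv (B.gcd id)) :
    canonicalSpectrum N B (L.image fun l => (q : ℤ) * l) ⊆
      (fun x : ℝ => (q : ℝ) * x) '' canonicalSpectrum N B L := by
  have hq0 : (q : ℝ) ≠ 0 := by exact_mod_cast hq
  have hd := gcd_ne_zero_of_two_le_card hB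
  refine canonicalSpectrum_subset (fun C hC x hx => ?_) ?_
  · have hCd := fun z (hz : z ∈ C) => hC.mem_intDiv hB hB0 hz
    obtain ⟨k, y, l, rfl, hl, hy, hm⟩ := hC
    have hl' : ∀ j, ∃ a ∈ L, (q : ℤ) * a = l j := fun j => Finset.mem_image.1 (hl j)
    choose a ha hal using hl'
    have hqy : ∀ j, (q : ℝ) * (y j / q) = y j := fun j => by field_simp
    have hya : ∀ j, tau N (a j) (y j / q) = y (j + 1) / q := by
      intro j
      rw [eq_div_iff hq0, mul_comm, ← tau_mul, hal, hqy, hy]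
    have hsub : (Set.range fun j => y j / (q : ℝ)) ⊆ attractor N L := by
      refine subset_attractor hN (Set.finite_range _).isBounded ?_
      rintro _ ⟨j, rfl⟩
      -- Subtraction is cyclic in `Fin (k + 1)`, so every point, including the one at index 0, has a
      -- predecessor.
      exact ⟨a (j - 1), ha _, y (j - 1) / q, ⟨_, rfl⟩, by rw [hya, sub_add_cancel]⟩
    have hC' : IsExtremeCycle N B L (Set.range fun j => y j / (q : ℝ)) := by
      refine ⟨k, _, a, rfl, ha, hya, fun j => ?_⟩
      rw [norm_mask_eq_one_iff hB hB0]
      refine hK ⟨hsub ⟨j, rfl⟩, ?_⟩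
      rw [mem_intDiv_mul_iff hd hq, hqy]
      exact hCd _ ⟨j, rfl⟩
    obtain ⟨j, rfl⟩ := hx
    refine ⟨-(y j / q), neg_mem_canonicalSpectrum hC' ⟨j, rfl⟩, ?_⟩
    change (q : ℝ) * -(y j / q) = _
    rw [mul_neg, hqy]
  · rintro _ ⟨s, hs, rfl⟩ l hl
    obtain ⟨a, ha, rfl⟩ := Finset.mem_image.1 hl
    refine ⟨N * s + a, mul_add_mem_canonicalSpectrum hs ha, ?_⟩
    push_cast
    ring

theorem attractor_inter_intDiv_subset (hN : 2 ≤ N) (hB : 2 ≤ B.card) (hB0 : (0 : ℤ) ∈ B)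
    (hq : q ≠ 0) (hqN : Nat.gcd q N = 1)
    (hΛ : canonicalSpectrum N B (L.image fun l => (q : ℤ) * l) ⊆
      (fun x : ℝ => (q : ℝ) * x) '' canonicalSpectrum N B L) :
    attractor N L ∩ intDiv ((q : ℤ) * B.gcd id) ⊆ intDiv (B.gcd id) := by
  have hq0 : (q : ℝ) ≠ 0 := by exact_mod_cast hq
  have hN0 : (N : ℝ) ≠ 0 := by positivity
  have hd := gcd_ne_zero_of_two_le_card hB
  have hqd : (q : ℤ) * B.gcd id ≠ 0 := mul_ne_zero (by exact_mod_cast hq) hd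
  rintro _ ⟨⟨c, rfl⟩, hx⟩
  by_contra hxd
  -- The tails of the coding, a backward orbit of the point: y_{n+1} = N y_n − c_n, so ℤ/(qd) is
  -- never left.
  let y : ℕ → ℝ := fun n => coding N L fun k => c (n + k)
  have hy : ∀ n, tau N (c n) (y (n + 1)) = y n := fun n => by
    simp only [y]
    rw [coding_eq hN fun k => c (n + k)]
    simp only [add_zero]
    congr 2
    funext k
    congr 1
    omega
  have hymem : ∀ n, y n ∈ intDiv ((q : ℤ) * B.gcd id) := by
    intro n
    induction n with
    | zero => simpa [y] using hx
    | succ n ih =>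
      have : y (n + 1) = ((N : ℤ) : ℝ) * y n - (c n : ℤ) := by
        rw [← hy n]
        unfold tau
        push_cast
        field_simp
        ring
      rw [this]
      exact intDiv_sub (intDiv_int_mul _ ih) (int_mem_intDiv hqd _)
  -- A tail in ℤ/d would, by coprimality of q and N, force the previous tail into ℤ/d, and so on
  -- back to the starting point.
  have hynot : ∀ n, y n ∉ intDiv (B.gcd id) := by
    intro n
    induction n with
    | zero => simpa [y] using hxd
    | succ n ih =>
      intro hmem
      apply ih
      rw [← hy n]
      refine mem_intDiv_of_tau hd (by omega) hqN hq hmem ?_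
      rw [hy n]
      exact hymem n
  obtain ⟨i, j, hij, hyij⟩ := Set.Finite.exists_lt_map_eq_of_forall_mem (f := y)
    (t := attractor N L ∩ intDiv ((q : ℤ) * B.gcd id)) (fun n => ⟨⟨_, rfl⟩, hymem n⟩) (finite_attractor_inter_intDiv (A := L) hN hqd)
  obtain ⟨k, rfl⟩ : ∃ k, j = i + (k + 1) := ⟨j - i - 1, by omega⟩
  -- The maps τ lower the index of y, so the cycle runs through the tails in decreasing order; the
  -- truncated subtractions are exact for the indices used. Scaling by q brings the points into ℤ/d,
  -- where |m_B| = 1.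
  obtain ⟨C, hC, hmem⟩ := exists_isExtremeCycle_of_periodic (N := N) (B := B)
    (L := L.image fun l => (q : ℤ) * l) (fun r => q * y (i + (k + 1) - r))
    (fun r => q * c (i + k - r)) k
    (fun r _ => Finset.mem_image_of_mem _ (c _).2)
    (fun r hr => by
      have h1 : i + (k + 1) - r = i + k - r + 1 := by omega
      have h2 : i + (k + 1) - (r + 1) = i + k - r := by omega
      rw [tau_mul, h1, hy, h2])
    (by simp [hyij])
    (fun r _ => by
      rw [norm_mask_eq_one_iff hB hB0]
      exact (mem_intDiv_mul_iff hd hq _).1 (hymem _))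
  obtain ⟨s, hs, hsq⟩ := hΛ (neg_mem_canonicalSpectrum hC hmem)
  have hs' := canonicalSpectrum_subset_intDiv hB hB0 hs
  have h3 : s = -y (i + (k + 1)) := by
    apply mul_left_cancel₀ hq0
    simpa using hsq
  apply hynot (i + (k + 1))
  rw [← neg_neg (y _), ← h3]
  exact intDiv_neg hs'

end Scaling

end CanonicalSpectrum

/-! ### The criterion for spectral eigenvalues -/

theorem proposition3p1 (N : ℕ) (B L : Finset ℤ)
    (hH : CanonicalSpectrum.IsHadamardTriple N B L)
    (hB0 : (0 : ℤ) ∈ B) (hL0 : (0 : ℤ) ∈ L) (hBN : B.card < N)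
    (q : ℕ) (hq : 2 ≤ q) (hqN : Nat.gcd q N = 1) :
    CanonicalSpectrum.IsSpectralEigenvalue (CanonicalSpectrum.selfSimilarMeasure N B)
        (CanonicalSpectrum.canonicalSpectrum N B L) (q : ℝ) ↔
      CanonicalSpectrum.attractor N L ∩ CanonicalSpectrum.intDiv ((q : ℤ) * B.gcd id) =
        CanonicalSpectrum.attractor N L ∩ CanonicalSpectrum.intDiv (B.gcd id) := by
  open CanonicalSpectrum in
  have hq0 : q ≠ 0 := by omega
  have hB := hH.two_le_card
  have hpair := hH.isSpectralPair hB0 hL0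
  have hpairq := (hH.image_mul hq0 hqN).isSpectralPair hB0
    (Finset.mem_image.2 ⟨0, hL0, by simp⟩)
  have hsub := mul_image_canonicalSpectrum_subset (N := N) (q := q) (L := L) hB hB0
  have hd := gcd_ne_zero_of_two_le_card hB
  constructor
  · rintro ⟨-, h⟩
    -- qΛ and Λ_q are nested spectra of the same measure, hence equal.
    have heq := h.eq_of_subset hpairq hsub
    have hK := attractor_inter_intDiv_subset hH.two_le hB hB0 hq0 hqN heq.ge
    exact Set.Subset.antisymm (fun x hx => ⟨hx.1, hK hx⟩)
      (Set.inter_subset_inter_right _ (intDiv_subset_mul hd hq0))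
  · intro hK
    have heq := hsub.antisymm (canonicalSpectrum_image_mul_subset hH.two_le hB hB0 hq0
      (hK.le.trans Set.inter_subset_right))
    refine ⟨hpair, ?_⟩
    rw [heq]
    exact hpairq
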